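/- Let $n\ge 1$. A convex body in $\mathbb{R}^n$ is a compact convex set with non-empty interior, $V$ is Lebesgue measure, $\mathcal H^{n-1}$ is $(n-1)$-dimensional Hausdorff measure, and $h_K(u)=\max\{\langle x,u\rangle : x\in K\}$ is the support function of $K$. For convex bodies $K,L$ containing the origin in their interior and $\lambda\in[0,1]$, the $L_0$-sum is $$(1-\lambda)\cdot K+_0\lambda\cdot L=\{x\in\mathbb{R}^n : \langle x,u\rangle\le h_K(u)^{1-\lambda}h_L(u)^{\lambda}\ \text{ for all } u\in S^{n-1}\}.$$ The surface area measure of $K$ is the Borel measure $S_K(\omega)=\mathcal H^{n-1}(\nu_K^{-1}(\omega))$ on $S^{n-1}$, where $\nu_K$ maps each boundary point of $K$ having a unique outer unit normal to that normal, and the cone volume measure of $K$ is $dV_K=\frac1n h_K\,dS_K$. Theorem. Let $\mathcal{C}$ be a class of convex bodies in $\mathbb{R}^n$ containing the origin in their interior such that $rK\in\mathcal{C}$ for all $K\in\mathcal{C}$ and $r>0$, such that $(1-\lambda)\cdot K+_0\lambda\cdot L\in\mathcal{C}$ for all $K,L\in\mathcal{C}$ and $\lambda\in[0,1]$, and such that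 $$V((1-\lambda)\cdot K+_0\lambda\cdot L)\ge V(K)^{1-\lambda}V(L)^{\lambda}\qquad\text{for all } K,L\in\mathcal{C},\ \lambda\in(0,1).$$ Then for all $K,L\in\mathcal{C}$ the function $\log\frac{h_L}{h_K}$ is $V_K$-integrable on $S^{n-1}$ and $$\int_{S^{n-1}}\log\frac{h_L}{h_K}\,dV_K\ \ge\ \frac{V(K)}{n}\log\frac{V(L)}{V(K)},$$ with equality if and only if $V(\tfrac12\cdot K+_0\tfrac12\cdot L)=V(K)^{1/2}V(L)^{1/2}$. Moreover, if $V_K=V_L$, then $V(\tfrac12\cdot K+_0\tfrac12\cdot L)=V(K)^{1/2}V(L)^{1/2}$. -/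

import Mathlib

open MeasureTheory
open scoped Pointwise

noncomputable section

namespace LogMinkowski

/-- A convex body in `ℝⁿ`: a compact convex set with non-empty interior. -/
structure IsConvexBody {n : ℕ} (K : Set (EuclideanSpace ℝ (Fin n))) : Prop where
  convex : Convex ℝ K
  isCompact : IsCompact K
  interior_nonempty : (interior K).Nonempty

/-- The support function `h_K(u) = max {⟨y, u⟩ : y ∈ K}` (the supremum is attained for compact
non-empty `K`). -/
def supportFn {n : ℕ} (K : Set (EuclideanSpace ℝ (Fin n))) (u : EuclideanSpace ℝ (Fin n)) : ℝ :=
  sSup ((fun y => inner ℝ y u) '' K)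

/-- The `L₀`-sum `(1 - t) · K +₀ t · L`, the Wulff shape of `h_K ^ (1 - t) * h_L ^ t`. -/
def L0Sum {n : ℕ} (t : ℝ) (K L : Set (EuclideanSpace ℝ (Fin n))) :
    Set (EuclideanSpace ℝ (Fin n)) :=
  {x | ∀ u ∈ Metric.sphere (0 : EuclideanSpace ℝ (Fin n)) 1,
    inner ℝ x u ≤ supportFn K u ^ (1 - t) * supportFn L u ^ t}

/-- `u` is a unit outer normal of `K` at the boundary point `x`. -/
def IsUnitNormal {n : ℕ} (K : Set (EuclideanSpace ℝ (Fin n))) (x : EuclideanSpace ℝ (Fin n))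
    (u : Metric.sphere (0 : EuclideanSpace ℝ (Fin n)) 1) : Prop :=
  x ∈ frontier K ∧ inner ℝ x (u : EuclideanSpace ℝ (Fin n)) = supportFn K u

/-- The set `∂'K` of smooth boundary points: those with exactly one unit outer normal. -/
def smoothBoundary {n : ℕ} (K : Set (EuclideanSpace ℝ (Fin n))) :
    Set (EuclideanSpace ℝ (Fin n)) :=
  {x | ∃! u : Metric.sphere (0 : EuclideanSpace ℝ (Fin n)) 1, IsUnitNormal K x u}

/-- The spherical image map `ν_K : ∂'K → S^{n-1}`. -/
def sphericalImage {n : ℕ} (K : Set (EuclideanSpace ℝ (Fin n))) (x : smoothBoundary K) :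
    Metric.sphere (0 : EuclideanSpace ℝ (Fin n)) 1 :=
  Classical.choose (ExistsUnique.exists x.2)

/-- The surface area measure `S_K` on `S^{n-1}`: the push-forward under `ν_K` of the
`(n-1)`-dimensional Hausdorff measure on `∂'K`, so `S_K(ω) = H^{n-1}(ν_K⁻¹(ω))`.  The Hausdorff
measure is the one normalised to agree with Lebesgue measure in dimension `n - 1`. -/
def surfaceAreaMeasure {n : ℕ} (K : Set (EuclideanSpace ℝ (Fin n))) :
    Measure (Metric.sphere (0 : EuclideanSpace ℝ (Fin n)) 1) :=
  Measure.map (sphericalImage K)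
    (Measure.comap (Subtype.val : smoothBoundary K → EuclideanSpace ℝ (Fin n))
      (Measure.euclideanHausdorffMeasure (n - 1)))

/-- The cone volume measure `dV_K = (1/n) h_K dS_K` on `S^{n-1}`. -/
def coneVolumeMeasure {n : ℕ} (K : Set (EuclideanSpace ℝ (Fin n))) :
    Measure (Metric.sphere (0 : EuclideanSpace ℝ (Fin n)) 1) :=
  (surfaceAreaMeasure K).withDensity
    (fun u => ENNReal.ofReal (1 / (n : ℝ) * supportFn K (u : EuclideanSpace ℝ (Fin n))))

/-- `𝒞` is a class of convex bodies containing the origin in their interior, closed under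
dilation and under the `L₀`-sum. -/
structure IsAdmissibleClass {n : ℕ} (C : Set (Set (EuclideanSpace ℝ (Fin n)))) : Prop where
  isConvexBody : ∀ K ∈ C, IsConvexBody K
  zero_mem_interior : ∀ K ∈ C, (0 : EuclideanSpace ℝ (Fin n)) ∈ interior K
  dilation_mem : ∀ K ∈ C, ∀ r : ℝ, 0 < r → r • K ∈ C
  L0Sum_mem : ∀ K ∈ C, ∀ L ∈ C, ∀ t ∈ Set.Icc (0 : ℝ) 1, L0Sum t K L ∈ C

end LogMinkowski

end

namespace LogMinkowski

open Set Metric Filter Topology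
open scoped NNReal ENNReal

variable {n : ℕ} {K L : Set (EuclideanSpace ℝ (Fin n))}

/-! Write `Q_t` for the `L₀`-sum with parameter `t`, `g` for gauges, and `l = log (V(L)/V(K))`. The
hypothesis says `V(Q_t) ≥ V(K) exp(t l)`, with equality at `t = 0`, so the inequality compares right
derivatives at `0`. The derivative of `V(Q_t)` is `n ∫ log(h_L/h_K) dV_K`, a logarithmic form of
Aleksandrov's variational formula.

Two representations over `K` give this derivative. Polar coordinates show that `V(Q_t)` is the
integral over `K` of `(g_K/g_{Q_t})^n` (`volume_eq_lintegral_gauge_div`). And `V_K` is the law of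
the normal at the radial projection of a Lebesgue point of `K` (`coneVolumeMeasure_eq_map`). The
latter is local: a boundary patch with normals near `u` is flattened almost isometrically onto the
supporting hyperplane, where the volume of a cone is height times base over `n`. Pointwise,
`log(g_K/g_{Q_t})` is at most `t log(h_L/h_K)` at the normal, and the quotient by `t` converges to
that value wherever the normal is unique, hence almost everywhere.

Equality in the integral inequality forces equality at `t = 1/2` by applying the inequality to `K`
and `Q_{1/2}`, because `h_{Q_{1/2}} ≤ (h_K h_L)^{1/2}`. Conversely, `Q_{1/2}` contains an `L₀`-sum
of `Q_t` and `L` for `t < 1/2`, so equality at `1/2` makes `V(Q_t)` at most log-linear there and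
reverses the derivative comparison. If `V_K = V_L`, the volumes agree and the inequalities for `(K,
L)` and `(L, K)` bound the same integral by `0` from both sides. -/

lemma bddAbove_inner (hK : IsCompact K) (u : EuclideanSpace ℝ (Fin n)) :
    BddAbove ((fun y => inner ℝ y u) '' K) :=
  (hK.image (by fun_prop)).bddAbove

lemma inner_le_supportFn (hK : IsCompact K) {x : EuclideanSpace ℝ (Fin n)} (hx : x ∈ K)
    (u : EuclideanSpace ℝ (Fin n)) : inner ℝ x u ≤ supportFn K u :=
  le_csSup (bddAbove_inner hK u) (mem_image_of_mem _ hx)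

lemma supportFn_le (hK : K.Nonempty) {u : EuclideanSpace ℝ (Fin n)} {c : ℝ}
    (h : ∀ x ∈ K, inner ℝ x u ≤ c) : supportFn K u ≤ c :=
  csSup_le (hK.image _) (by rintro _ ⟨x, hx, rfl⟩; exact h x hx)

/-- A convex body containing the origin in its interior. -/
structure IsCenteredBody (K : Set (EuclideanSpace ℝ (Fin n))) : Prop extends IsConvexBody K where
  zero_mem_interior : (0 : EuclideanSpace ℝ (Fin n)) ∈ interior K

/-! ### Support functions, gauges and normals -/

namespace IsCenteredBody

lemma mem_nhds (hK : IsCenteredBody K) : K ∈ 𝓝 (0 : EuclideanSpace ℝ (Fin n)) :=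
  mem_interior_iff_mem_nhds.1 hK.zero_mem_interior

lemma zero_mem (hK : IsCenteredBody K) : (0 : EuclideanSpace ℝ (Fin n)) ∈ K :=
  mem_of_mem_nhds hK.mem_nhds

lemma nonempty (hK : IsCenteredBody K) : K.Nonempty := ⟨0, hK.zero_mem⟩

lemma absorbent (hK : IsCenteredBody K) : Absorbent ℝ K := absorbent_nhds_zero hK.mem_nhds

lemma isClosed (hK : IsCenteredBody K) : IsClosed K := hK.isCompact.isClosed

lemma exists_closedBall_subset (hK : IsCenteredBody K) :
    ∃ r > 0, closedBall (0 : EuclideanSpace ℝ (Fin n)) r ⊆ K :=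
  nhds_basis_closedBall.mem_iff.1 hK.mem_nhds

lemma exists_norm_le (hK : IsCenteredBody K) : ∃ R > 0, ∀ x ∈ K, ‖x‖ ≤ R := by
  obtain ⟨R, hR⟩ := hK.isCompact.isBounded.exists_norm_le
  exact ⟨max R 1, by positivity, fun x hx => (hR x hx).trans (le_max_left _ _)⟩

lemma mul_norm_le_supportFn (hK : IsCenteredBody K) {r : ℝ} (hr : 0 < r)
    (h : closedBall (0 : EuclideanSpace ℝ (Fin n)) r ⊆ K) (u : EuclideanSpace ℝ (Fin n)) :
    r * ‖u‖ ≤ supportFn K u := by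
  rcases eq_or_ne u 0 with rfl | hu
  · simpa using inner_le_supportFn hK.isCompact hK.zero_mem 0
  have hu' : ‖u‖ ≠ 0 := norm_ne_zero_iff.2 hu
  have := inner_le_supportFn hK.isCompact (x := (r / ‖u‖) • u)
    (h (by simp [norm_smul, abs_of_pos hr, hu'])) u
  rw [inner_smul_left, real_inner_self_eq_norm_sq] at this
  calc r * ‖u‖ = r / ‖u‖ * ‖u‖ ^ 2 := by field_simp
    _ ≤ _ := this

lemma supportFn_pos (hK : IsCenteredBody K) {u : EuclideanSpace ℝ (Fin n)} (hu : u ≠ 0) :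
    0 < supportFn K u := by
  obtain ⟨r, hr, h⟩ := hK.exists_closedBall_subset
  exact lt_of_lt_of_le (by positivity) (hK.mul_norm_le_supportFn hr h u)

lemma supportFn_pos_of_sphere (hK : IsCenteredBody K)
    (u : sphere (0 : EuclideanSpace ℝ (Fin n)) 1) : 0 < supportFn K u :=
  hK.supportFn_pos (ne_zero_of_mem_unit_sphere u)

lemma supportFn_sub_le (hK : IsCenteredBody K) {R : ℝ} (hR : ∀ x ∈ K, ‖x‖ ≤ R)
    (u v : EuclideanSpace ℝ (Fin n)) : supportFn K u - supportFn K v ≤ R * ‖u - v‖ := by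
  rw [sub_le_iff_le_add]
  refine supportFn_le hK.nonempty fun x hx => ?_
  have h1 := inner_le_supportFn hK.isCompact hx v
  have h2 : inner ℝ x (u - v) ≤ R * ‖u - v‖ :=
    (real_inner_le_norm _ _).trans (by gcongr; exact hR x hx)
  rw [inner_sub_right] at h2
  linarith

lemma abs_supportFn_sub_le (hK : IsCenteredBody K) {R : ℝ} (hR : ∀ x ∈ K, ‖x‖ ≤ R)
    (u v : EuclideanSpace ℝ (Fin n)) : |supportFn K u - supportFn K v| ≤ R * ‖u - v‖ := by
  rw [abs_le]
  have := hK.supportFn_sub_le hR u v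
  have := hK.supportFn_sub_le hR v u
  rw [norm_sub_rev] at this
  constructor <;> linarith

lemma continuous_supportFn (hK : IsCenteredBody K) : Continuous (supportFn K) := by
  obtain ⟨R, -, hR⟩ := hK.exists_norm_le
  refine (LipschitzWith.of_dist_le' (K := R) fun u v => ?_).continuous
  rw [Real.dist_eq, dist_eq_norm]
  exact hK.abs_supportFn_sub_le hR u v

lemma gauge_le_one_iff (hK : IsCenteredBody K) {x : EuclideanSpace ℝ (Fin n)} :
    gauge K x ≤ 1 ↔ x ∈ K := by
  rw [gauge_le_one_iff_mem_closure hK.convex hK.mem_nhds, hK.isClosed.closure_eq]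

lemma gauge_eq_one_iff (hK : IsCenteredBody K) {x : EuclideanSpace ℝ (Fin n)} :
    gauge K x = 1 ↔ x ∈ frontier K :=
  gauge_eq_one_iff_mem_frontier hK.convex hK.mem_nhds

lemma continuous_gauge (hK : IsCenteredBody K) : Continuous (gauge K) :=
  _root_.continuous_gauge hK.convex hK.mem_nhds

lemma gauge_pos (hK : IsCenteredBody K) {x : EuclideanSpace ℝ (Fin n)} (hx : x ≠ 0) :
    0 < gauge K x :=
  (_root_.gauge_pos hK.absorbent
    (NormedSpace.isVonNBounded_iff ℝ |>.2 hK.isCompact.isBounded)).2 hx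

lemma gauge_smul (_hK : IsCenteredBody K) {t : ℝ} (ht : 0 ≤ t) (x : EuclideanSpace ℝ (Fin n)) :
    gauge K (t • x) = t * gauge K x := by
  simpa using gauge_smul_of_nonneg (s := K) ht x

lemma inv_gauge_smul_mem_frontier (hK : IsCenteredBody K) {x : EuclideanSpace ℝ (Fin n)}
    (hx : x ≠ 0) : (gauge K x)⁻¹ • x ∈ frontier K := by
  have := hK.gauge_pos hx
  rw [← hK.gauge_eq_one_iff, hK.gauge_smul (by positivity), inv_mul_cancel₀ this.ne']

lemma inner_le_supportFn_mul_gauge (hK : IsCenteredBody K) (x u : EuclideanSpace ℝ (Fin n)) :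
    inner ℝ x u ≤ supportFn K u * gauge K x := by
  rcases eq_or_ne x 0 with rfl | hx
  · simp
  have hg := hK.gauge_pos hx
  have := inner_le_supportFn hK.isCompact
    (hK.isClosed.frontier_subset (hK.inv_gauge_smul_mem_frontier hx)) u
  rw [inner_smul_left] at this
  simp only [conj_trivial] at this
  rwa [inv_mul_le_iff₀ hg, mul_comm] at this

/-- Hahn–Banach separates `x` from the interior, and the inequality passes to the closure. Strict
separation at the origin makes the separating vector nonzero, so it can be normalised. -/
lemma exists_isUnitNormal (hK : IsCenteredBody K) {x : EuclideanSpace ℝ (Fin n)}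
    (hx : x ∈ frontier K) : ∃ u, IsUnitNormal K x u := by
  obtain ⟨f, hf⟩ := geometric_hahn_banach_open_point hK.convex.interior isOpen_interior
    (fun h => hx.2 h)
  set v := (InnerProductSpace.toDual ℝ (EuclideanSpace ℝ (Fin n))).symm f with hv
  have hfv : ∀ y, f y = inner ℝ y v := fun y => by
    rw [real_inner_comm, hv, InnerProductSpace.toDual_symm_apply]
  have hle : ∀ y ∈ K, inner ℝ y v ≤ inner ℝ x v := by
    intro y hy
    have hcl : y ∈ closure (interior K) := by
      rw [hK.convex.closure_interior_eq_closure_of_nonempty_interior hK.interior_nonempty]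
      exact subset_closure hy
    have : closure (interior K) ⊆ {y | inner ℝ y v ≤ inner ℝ x v} := by
      refine closure_minimal (fun z hz => ?_) (isClosed_le (by fun_prop) (by fun_prop))
      have := hf z hz
      rw [hfv, hfv] at this
      exact this.le
    exact this hcl
  have hv0 : v ≠ 0 := by
    intro h
    have := hf 0 hK.zero_mem_interior
    simp [hfv, h] at this
  have hvn : 0 < ‖v‖ := norm_pos_iff.2 hv0
  refine ⟨⟨‖v‖⁻¹ • v, by simp [norm_smul, hvn.ne']⟩, hx, le_antisymm
    (inner_le_supportFn hK.isCompact (hK.isClosed.frontier_subset hx) _)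
    (supportFn_le hK.nonempty fun y hy => ?_)⟩
  simp only [inner_smul_right]
  have := hle y hy
  gcongr

lemma volume_pos (hK : IsCenteredBody K) : 0 < volume K :=
  Measure.measure_pos_of_mem_nhds _ hK.mem_nhds

lemma volume_lt_top (hK : IsCenteredBody K) : volume K < ⊤ := hK.isCompact.measure_lt_top

lemma volume_real_pos (hK : IsCenteredBody K) : 0 < volume.real K :=
  ENNReal.toReal_pos hK.volume_pos.ne' hK.volume_lt_top.ne

end IsCenteredBody

/-! ### Smooth boundary points and the spherical image -/

lemma isUnitNormal_sphericalImage (x : smoothBoundary K) :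
    IsUnitNormal K x (sphericalImage K x) :=
  Classical.choose_spec (ExistsUnique.exists x.2)

lemma sphericalImage_eq (x : smoothBoundary K) {u : sphere (0 : EuclideanSpace ℝ (Fin n)) 1}
    (hu : IsUnitNormal K x u) : sphericalImage K x = u :=
  x.2.unique (isUnitNormal_sphericalImage x) hu

lemma smoothBoundary_subset_frontier : smoothBoundary K ⊆ frontier K := by
  rintro x ⟨u, hu, -⟩
  exact hu.1

namespace IsCenteredBody

lemma isClosed_isUnitNormal (hK : IsCenteredBody K) :
    IsClosed {p : EuclideanSpace ℝ (Fin n) × sphere (0 : EuclideanSpace ℝ (Fin n)) 1 |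
      IsUnitNormal K p.1 p.2} := by
  have := hK.continuous_supportFn
  exact (isClosed_frontier.preimage continuous_fst).inter
    (isClosed_eq (by fun_prop) (by fun_prop))

lemma isCompact_frontier (hK : IsCenteredBody K) : IsCompact (frontier K) :=
  hK.isCompact.of_isClosed_subset isClosed_frontier hK.isClosed.frontier_subset

lemma isCompact_isUnitNormal (hK : IsCenteredBody K) :
    IsCompact {p : EuclideanSpace ℝ (Fin n) × sphere (0 : EuclideanSpace ℝ (Fin n)) 1 |
      IsUnitNormal K p.1 p.2} :=
  (hK.isCompact_frontier.prod isCompact_univ).of_isClosed_subset hK.isClosed_isUnitNormal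
    fun _ hp => ⟨hp.1, mem_univ _⟩

/-- The normal relation is compact, so the boundary points with some normal in a closed `ω` form a
closed set; its trace on the smooth boundary is the preimage of `ω`. -/
lemma continuous_sphericalImage (hK : IsCenteredBody K) : Continuous (sphericalImage K) := by
  rw [continuous_iff_isClosed]
  intro ω hω
  have hc : IsClosed (Prod.fst '' ({p : EuclideanSpace ℝ (Fin n) ×
      sphere (0 : EuclideanSpace ℝ (Fin n)) 1 | IsUnitNormal K p.1 p.2} ∩ Prod.snd ⁻¹' ω)) :=
    ((hK.isCompact_isUnitNormal.inter_right (hω.preimage continuous_snd)).image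
      continuous_fst).isClosed
  convert hc.preimage (continuous_subtype_val : Continuous (Subtype.val : smoothBoundary K → _))
  ext x
  simp only [mem_preimage, mem_image, mem_inter_iff, mem_ofPred_eq, Prod.exists]
  constructor
  · exact fun h => ⟨x, _, ⟨isUnitNormal_sphericalImage x, h⟩, rfl⟩
  · rintro ⟨y, u, ⟨h1, h2⟩, rfl⟩
    rwa [sphericalImage_eq x h1]

/-- The points with two normals at distance at least `1/(k+1)` form a projection of a compact set,
so the singular points are a countable union of compact sets. -/
lemma measurableSet_smoothBoundary (hK : IsCenteredBody K) :
    MeasurableSet (smoothBoundary K) := by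
  set G : ℕ → Set (EuclideanSpace ℝ (Fin n) × (sphere (0 : EuclideanSpace ℝ (Fin n)) 1 ×
      sphere (0 : EuclideanSpace ℝ (Fin n)) 1)) := fun k =>
    {p | IsUnitNormal K p.1 p.2.1 ∧ IsUnitNormal K p.1 p.2.2 ∧ 1 / ((k : ℝ) + 1) ≤ dist p.2.1 p.2.2}
    with hG
  have hGc : ∀ k, IsCompact (G k) := fun k => by
    refine (hK.isCompact_frontier.prod isCompact_univ).of_isClosed_subset ?_
      fun _ hp => ⟨hp.1.1, mem_univ _⟩
    refine IsClosed.inter (hK.isClosed_isUnitNormal.preimage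
      (continuous_fst.prodMk (continuous_fst.comp continuous_snd)))
      (IsClosed.inter (hK.isClosed_isUnitNormal.preimage
        (continuous_fst.prodMk (continuous_snd.comp continuous_snd))) ?_)
    exact isClosed_le continuous_const
      ((continuous_fst.comp continuous_snd).dist (continuous_snd.comp continuous_snd))
  have : smoothBoundary K = frontier K \ ⋃ k, Prod.fst '' G k := by
    ext x
    constructor
    · intro hx
      refine ⟨smoothBoundary_subset_frontier hx, ?_⟩
      simp only [mem_iUnion, mem_image, not_exists, not_and]
      rintro k ⟨y, u, v⟩ ⟨h1, h2, h3⟩ rfl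
      have := hx.unique h1 h2
      dsimp only at this h3
      rw [this, dist_self] at h3
      exact absurd h3 (not_le.2 (by positivity))
    · rintro ⟨hx, hn⟩
      obtain ⟨u, hu⟩ := hK.exists_isUnitNormal hx
      refine ⟨u, hu, fun v hv => ?_⟩
      by_contra hne
      obtain ⟨k, hk⟩ := exists_nat_one_div_lt (dist_pos.2 hne)
      exact hn (mem_iUnion.2 ⟨k, (x, v, u), ⟨hv, hu, hk.le⟩, rfl⟩)
  rw [this]
  exact isClosed_frontier.measurableSet.diff
    (MeasurableSet.iUnion fun k => ((hGc k).image continuous_fst).measurableSet)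

lemma isUnitNormal_inv_gauge_smul_iff (hK : IsCenteredBody K) {x : EuclideanSpace ℝ (Fin n)}
    (hx : x ≠ 0) {u : sphere (0 : EuclideanSpace ℝ (Fin n)) 1} :
    IsUnitNormal K ((gauge K x)⁻¹ • x) u ↔
      inner ℝ x (u : EuclideanSpace ℝ (Fin n)) = supportFn K u * gauge K x := by
  have hg := hK.gauge_pos hx
  simp only [IsUnitNormal, hK.inv_gauge_smul_mem_frontier hx, true_and, inner_smul_left,
    conj_trivial]
  rw [inv_mul_eq_iff_eq_mul₀ hg.ne', mul_comm]

/-- For a normal `w`, the function `h_K(w) g_K - ⟨·, w⟩` is nonnegative and vanishes at `x`, so the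
gradient of the gauge there is `w / h_K(w)`. Two normals are thus positive multiples of each other,
and unit length makes them equal. -/
lemma isUnitNormal_unique_of_differentiableAt (hK : IsCenteredBody K)
    {x : EuclideanSpace ℝ (Fin n)} (hx : x ≠ 0) (hd : DifferentiableAt ℝ (gauge K) x)
    {u v : sphere (0 : EuclideanSpace ℝ (Fin n)) 1}
    (hu : IsUnitNormal K ((gauge K x)⁻¹ • x) u) (hv : IsUnitNormal K ((gauge K x)⁻¹ • x) v) :
    u = v := by
  have key : ∀ w : sphere (0 : EuclideanSpace ℝ (Fin n)) 1,
      IsUnitNormal K ((gauge K x)⁻¹ • x) w → ∀ y, supportFn K w * fderiv ℝ (gauge K) x y =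
        inner ℝ y (w : EuclideanSpace ℝ (Fin n)) := by
    intro w hw y
    rw [hK.isUnitNormal_inv_gauge_smul_iff hx] at hw
    have hmin : IsLocalMin (fun z => supportFn K w * gauge K z -
        inner ℝ z (w : EuclideanSpace ℝ (Fin n))) x := by
      refine Eventually.of_forall fun z => ?_
      have := hK.inner_le_supportFn_mul_gauge z w
      dsimp only
      linarith
    have h1 : HasFDerivAt (fun z => supportFn K w * gauge K z -
        inner ℝ z (w : EuclideanSpace ℝ (Fin n)))
        (supportFn K w • fderiv ℝ (gauge K) x -
          (innerSL ℝ (w : EuclideanSpace ℝ (Fin n)))) x := by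
      refine (hd.hasFDerivAt.const_mul _).sub ?_
      have h2 := (innerSL ℝ (w : EuclideanSpace ℝ (Fin n))).hasFDerivAt (x := x)
      simpa [real_inner_comm] using h2
    have h3 := congrArg (fun f => f y) (hmin.hasFDerivAt_eq_zero h1)
    simp only [sub_apply, smul_apply, smul_eq_mul,
      innerSL_apply_apply, zero_apply] at h3
    rw [real_inner_comm]
    linarith
  have hpu := hK.supportFn_pos_of_sphere u
  have hpv := hK.supportFn_pos_of_sphere v
  have hsm : supportFn K v • (u : EuclideanSpace ℝ (Fin n)) = supportFn K u • (v : _) := by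
    refine ext_inner_left ℝ fun y => ?_
    rw [inner_smul_right, inner_smul_right, ← key u hu, ← key v hv]
    ring
  have hn := congrArg norm hsm
  simp only [norm_smul, Real.norm_eq_abs, abs_of_pos hpu, abs_of_pos hpv,
    norm_eq_of_mem_sphere, mul_one] at hn
  rw [hn] at hsm
  exact Subtype.ext (smul_right_injective _ hpu.ne' hsm)

/-- Almost every ray meets the boundary of a convex body in a smooth point. -/
lemma ae_mem_smoothBoundary (hK : IsCenteredBody K) (hn : 1 ≤ n) :
    ∀ᵐ x : EuclideanSpace ℝ (Fin n), x ≠ 0 ∧ (gauge K x)⁻¹ • x ∈ smoothBoundary K := by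
  have : Nonempty (Fin n) := ⟨⟨0, hn⟩⟩
  -- The gauge is Lipschitz, so Rademacher's theorem applies.
  obtain ⟨C, hC⟩ := hK.convex.lipschitz_gauge hK.mem_nhds
  filter_upwards [hC.ae_differentiableAt (μ := volume), Measure.ae_ne volume 0] with x hd hx
  refine ⟨hx, ?_⟩
  obtain ⟨u, hu⟩ := hK.exists_isUnitNormal (hK.inv_gauge_smul_mem_frontier hx)
  exact ⟨u, hu, fun v hv => hK.isUnitNormal_unique_of_differentiableAt hx hd hv hu⟩

end IsCenteredBody

open Classical in
/-- The outer normal at the boundary point on the ray through `x`, where it is unique; `u₀`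
elsewhere. -/
noncomputable def coneNormal (K : Set (EuclideanSpace ℝ (Fin n)))
    (u₀ : sphere (0 : EuclideanSpace ℝ (Fin n)) 1) (x : EuclideanSpace ℝ (Fin n)) :
    sphere (0 : EuclideanSpace ℝ (Fin n)) 1 :=
  if h : (gauge K x)⁻¹ • x ∈ smoothBoundary K then sphericalImage K ⟨_, h⟩ else u₀

lemma coneNormal_of_mem {u₀ : sphere (0 : EuclideanSpace ℝ (Fin n)) 1}
    {x : EuclideanSpace ℝ (Fin n)} (h : (gauge K x)⁻¹ • x ∈ smoothBoundary K) :
    coneNormal K u₀ x = sphericalImage K ⟨_, h⟩ := dif_pos h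

namespace IsCenteredBody

lemma measurable_inv_gauge_smul (hK : IsCenteredBody K) :
    Measurable fun x : EuclideanSpace ℝ (Fin n) => (gauge K x)⁻¹ • x :=
  hK.continuous_gauge.measurable.inv.smul measurable_id

lemma measurable_coneNormal (hK : IsCenteredBody K)
    (u₀ : sphere (0 : EuclideanSpace ℝ (Fin n)) 1) : Measurable (coneNormal K u₀) := by
  classical
  exact Measurable.dite (s := {x | (gauge K x)⁻¹ • x ∈ smoothBoundary K})
    (f := fun x => sphericalImage K ⟨(gauge K x.1)⁻¹ • x.1, x.2⟩) (g := fun _ => u₀)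
    (hK.continuous_sphericalImage.measurable.comp
      (hK.measurable_inv_gauge_smul.comp measurable_subtype_coe).subtype_mk) measurable_const
    (hK.measurable_inv_gauge_smul hK.measurableSet_smoothBoundary)

lemma inner_coneNormal (hK : IsCenteredBody K) {u₀ : sphere (0 : EuclideanSpace ℝ (Fin n)) 1}
    {x : EuclideanSpace ℝ (Fin n)} (hx : x ≠ 0) (h : (gauge K x)⁻¹ • x ∈ smoothBoundary K) :
    inner ℝ x (coneNormal K u₀ x : EuclideanSpace ℝ (Fin n)) =
      supportFn K (coneNormal K u₀ x) * gauge K x := by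
  rw [coneNormal_of_mem h, ← hK.isUnitNormal_inv_gauge_smul_iff hx]
  exact isUnitNormal_sphericalImage ⟨_, h⟩

end IsCenteredBody

/-! ### Volume of cones over flat sets -/

/-- The union of the half-open segments from the origin to the points of `A`. -/
def segmentCone (A : Set (EuclideanSpace ℝ (Fin n))) : Set (EuclideanSpace ℝ (Fin n)) :=
  {z | ∃ t ∈ Ioc (0 : ℝ) 1, ∃ x ∈ A, z = t • x}

/-- The orthogonal decomposition `ℝ × u^⊥ ≃ ℝⁿ` for a unit vector `u`, as an isometry. -/
lemma exists_orthogonal_isometry {u : EuclideanSpace ℝ (Fin n)} (hu : ‖u‖ = 1) :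
    ∃ J : WithLp 2 (ℝ × (ℝ ∙ u)ᗮ) ≃ₗᵢ[ℝ] EuclideanSpace ℝ (Fin n),
      ∀ s p, J (WithLp.toLp 2 (s, p)) = s • u + (p : EuclideanSpace ℝ (Fin n)) := by
  let f : WithLp 2 (ℝ × (ℝ ∙ u)ᗮ) →ₗ[ℝ] EuclideanSpace ℝ (Fin n) :=
    ((LinearMap.toSpanSingleton ℝ _ u).coprod (ℝ ∙ u)ᗮ.subtype) ∘ₗ
      (WithLp.linearEquiv 2 ℝ (ℝ × (ℝ ∙ u)ᗮ)).toLinearMap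
  have hf : ∀ s p, f (WithLp.toLp 2 (s, p)) = s • u + (p : EuclideanSpace ℝ (Fin n)) := by
    intro s p
    simp [f]
  let F : WithLp 2 (ℝ × (ℝ ∙ u)ᗮ) →ₗᵢ[ℝ] EuclideanSpace ℝ (Fin n) :=
    { f with
      norm_map' := by
        intro z
        change ‖f z‖ = ‖z‖
        obtain ⟨s, p⟩ := z
        rw [hf]
        rw [← sq_eq_sq₀ (norm_nonneg _) (norm_nonneg _), WithLp.prod_norm_sq_eq_of_L2]
        have h0 : inner ℝ (s • u) (p : EuclideanSpace ℝ (Fin n)) = 0 := by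
          rw [inner_smul_left, Submodule.mem_orthogonal_singleton_iff_inner_right.1 p.2, mul_zero]
        have := norm_add_sq_eq_norm_sq_add_norm_sq_real h0
        simp only [← sq] at this
        rw [this, norm_smul, hu]
        simp }
  have hsurj : Function.Surjective F := by
    intro x
    refine ⟨WithLp.toLp 2 (inner ℝ u x, ⟨x - inner ℝ u x • u, ?_⟩), ?_⟩
    · rw [Submodule.mem_orthogonal_singleton_iff_inner_right, inner_sub_right, inner_smul_right,
        real_inner_self_eq_norm_sq, hu]
      ring
    · change f _ = x
      rw [hf]
      simp
  exact ⟨LinearIsometryEquiv.ofSurjective F hsurj, hf⟩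

lemma lintegral_Ioc_div_pow {h : ℝ} (hh : 0 < h) (m : ℕ) :
    ∫⁻ s in Ioc 0 h, ENNReal.ofReal ((s / h) ^ m) = ENNReal.ofReal (h / (m + 1)) := by
  rw [← ofReal_integral_eq_lintegral_ofReal]
  · rw [← intervalIntegral.integral_of_le hh.le]
    congr 1
    simp only [div_pow, intervalIntegral.integral_div, integral_pow]
    field_simp
    simp [pow_succ]
  · exact (by fun_prop : Continuous fun s : ℝ => (s / h) ^ m).integrableOn_Ioc
  · filter_upwards [ae_restrict_mem measurableSet_Ioc] with s hs
    exact pow_nonneg (div_nonneg hs.1.le hh.le) _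

/-- The volume of the cone with apex at the origin over a set in a hyperplane. -/
lemma volume_segmentCone_of_flat (hn : 1 ≤ n) {u : EuclideanSpace ℝ (Fin n)} (hu : ‖u‖ = 1)
    {h : ℝ} (hh : 0 < h) {F : Set (EuclideanSpace ℝ (Fin n))} (hF : MeasurableSet F)
    (hFh : ∀ x ∈ F, inner ℝ x u = h) :
    volume (segmentCone F) =
      ENNReal.ofReal (h / n) * Measure.euclideanHausdorffMeasure (n - 1) F := by
  obtain ⟨m, rfl⟩ : ∃ m, n = m + 1 := ⟨n - 1, by omega⟩
  obtain ⟨J, hJ⟩ := exists_orthogonal_isometry hu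
  have hdim : Module.finrank ℝ (ℝ ∙ u)ᗮ = m := by
    have : Fact (Module.finrank ℝ (EuclideanSpace ℝ (Fin (m + 1))) = m + 1) := ⟨by simp⟩
    exact Submodule.finrank_orthogonal_span_singleton (by rintro rfl; simp at hu)
  set j : (ℝ ∙ u)ᗮ → EuclideanSpace ℝ (Fin (m + 1)) := fun p => h • u + p with hj
  have hjiso : Isometry j := Isometry.of_dist_eq fun p q => by simp [hj, Subtype.dist_eq]
  set B := j ⁻¹' F with hB
  have hBm : MeasurableSet B := hjiso.continuous.measurable hF
  have hort : ∀ p : (ℝ ∙ u)ᗮ, inner ℝ (p : EuclideanSpace ℝ (Fin (m + 1))) u = 0 := fun p =>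
    Submodule.mem_orthogonal_singleton_iff_inner_left.1 p.2
  have hjB : j '' B = F := by
    rw [hB, image_preimage_eq_iff]
    intro x hx
    refine ⟨⟨x - h • u, ?_⟩, by simp [hj]⟩
    rw [Submodule.mem_orthogonal_singleton_iff_inner_left, inner_sub_left, inner_smul_left,
      real_inner_self_eq_norm_sq, hu, hFh x hx]
    simp
  -- The translation `j` is an isometry, and normalised Hausdorff measure on `u^⊥` is its Lebesgue
  -- measure.
  have hvolB : Measure.euclideanHausdorffMeasure (m + 1 - 1) F = volume B := by
    rw [← hjB, hjiso.euclideanHausdorffMeasure_image,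
      ← InnerProductSpace.euclideanHausdorffMeasure_eq_volume,
      hdim, Nat.add_sub_cancel]
  have hpre : MeasurePreserving (fun z : ℝ × (ℝ ∙ u)ᗮ => J (WithLp.toLp 2 z)) volume volume :=
    J.measurePreserving.comp (WithLp.volume_preserving_toLp ℝ (ℝ ∙ u)ᗮ)
  have hemb : MeasurableEmbedding (fun z : ℝ × (ℝ ∙ u)ᗮ => J (WithLp.toLp 2 z)) :=
    J.toHomeomorph.measurableEmbedding.comp
      (MeasurableEquiv.toLp 2 (ℝ × (ℝ ∙ u)ᗮ)).measurableEmbedding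
  -- At height `s` the slice of the cone is `B` scaled by `s / h`; Fubini then integrates `(s /
  -- h)^m` times the volume of `B`.
  have hset : (fun z : ℝ × (ℝ ∙ u)ᗮ => J (WithLp.toLp 2 z)) ⁻¹' segmentCone F =
      {z | z.1 ∈ Ioc 0 h ∧ (h / z.1) • z.2 ∈ B} := by
    ext ⟨s, p⟩
    simp only [mem_preimage, hJ, segmentCone, mem_ofPred_eq]
    constructor
    · rintro ⟨t, ht, x, hx, hxt⟩
      have hs : s = t * h := by
        have := congrArg (fun y => inner ℝ y u) hxt
        simpa [inner_add_left, inner_smul_left, hort, hu, hFh x hx] using this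
      have ht0 := ht.1
      refine ⟨⟨by rw [hs]; positivity, by rw [hs]; nlinarith [ht.2]⟩, ?_⟩
      have : j ((h / s) • p) = x := by
        have hst : h / s = t⁻¹ := by rw [hs]; field_simp
        rw [hj]
        simp only [hst, Submodule.coe_smul]
        have : (p : EuclideanSpace ℝ (Fin (m + 1))) = t • x - s • u := by
          rw [← hxt]; simp
        rw [this, smul_sub, smul_smul, smul_smul, inv_mul_cancel₀ ht0.ne', one_smul, hs,
          ← mul_assoc, inv_mul_cancel₀ ht0.ne', one_mul]
        simp
      rw [hB, mem_preimage, this]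
      exact hx
    · rintro ⟨hs, hp⟩
      have hs0 := hs.1
      refine ⟨s / h, ⟨by positivity, (div_le_one hh).2 hs.2⟩, _, hp, ?_⟩
      simp only [hj, Submodule.coe_smul, smul_add, smul_smul]
      rw [div_mul_cancel₀ _ hh.ne', div_mul_div_cancel₀ hh.ne', div_self hs0.ne', one_smul]
  have hSm : MeasurableSet {z : ℝ × (ℝ ∙ u)ᗮ | z.1 ∈ Ioc 0 h ∧ (h / z.1) • z.2 ∈ B} := by
    refine (measurable_fst measurableSet_Ioc).inter ?_
    have : Measurable fun z : ℝ × (ℝ ∙ u)ᗮ => (h / z.1) • z.2 := by fun_prop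
    exact this hBm
  rw [← hpre.measure_preimage_emb hemb, hset, Measure.volume_eq_prod, Measure.prod_apply hSm,
    hvolB]
  have hslice : ∀ s : ℝ, volume (Prod.mk s ⁻¹'
      {z : ℝ × (ℝ ∙ u)ᗮ | z.1 ∈ Ioc 0 h ∧ (h / z.1) • z.2 ∈ B})
      = (Ioc 0 h).indicator (fun s => ENNReal.ofReal ((s / h) ^ m) * volume B) s := by
    intro s
    by_cases hs : s ∈ Ioc 0 h
    · rw [indicator_of_mem hs]
      have hs0 := hs.1
      have : Prod.mk s ⁻¹' {z : ℝ × (ℝ ∙ u)ᗮ | z.1 ∈ Ioc 0 h ∧ (h / z.1) • z.2 ∈ B} =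
          (fun p => (h / s) • p) ⁻¹' B := by
        ext p; simp only [mem_preimage, mem_ofPred_eq, hs, true_and]
      rw [this, Measure.addHaar_preimage_smul _ (by positivity), hdim]
      congr 2
      rw [abs_of_pos (by positivity), ← inv_pow, inv_div]
    · rw [indicator_of_notMem hs]
      have : Prod.mk s ⁻¹' {z : ℝ × (ℝ ∙ u)ᗮ | z.1 ∈ Ioc 0 h ∧ (h / z.1) • z.2 ∈ B} = ∅ := by
        ext p; simp only [mem_preimage, mem_ofPred_eq, hs, false_and, mem_empty_iff_false]
      rw [this, measure_empty]
  simp_rw [hslice]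
  rw [lintegral_indicator measurableSet_Ioc, lintegral_mul_const _ (by fun_prop),
    lintegral_Ioc_div_pow hh]
  push_cast
  rfl

/-! ### Hausdorff measure under bi-Lipschitz maps, and localisation -/

section Lipschitz

variable {X Y : Type*} [MetricSpace X] [MeasurableSpace X] [BorelSpace X]
  [MetricSpace Y] [MeasurableSpace Y] [BorelSpace Y]

lemma euclideanHausdorffMeasure_image_le {c : ℝ≥0} {f : X → Y} {s : Set X}
    (hf : LipschitzOnWith c f s) (d : ℕ) :
    Measure.euclideanHausdorffMeasure d (f '' s) ≤
      (c : ℝ≥0∞) ^ d * Measure.euclideanHausdorffMeasure d s := by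
  have h := hf.hausdorffMeasure_image_le (Nat.cast_nonneg d)
  rw [ENNReal.rpow_natCast] at h
  simp only [Measure.euclideanHausdorffMeasure_def, Measure.smul_apply, ENNReal.smul_def,
    smul_eq_mul]
  rw [mul_left_comm]
  gcongr

lemma euclideanHausdorffMeasure_le_image {c : ℝ≥0} {f : X → Y} {s : Set X}
    (hf : ∀ x ∈ s, ∀ y ∈ s, dist x y ≤ c * dist (f x) (f y)) (d : ℕ) :
    Measure.euclideanHausdorffMeasure d s ≤
      (c : ℝ≥0∞) ^ d * Measure.euclideanHausdorffMeasure d (f '' s) := by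
  rcases s.eq_empty_or_nonempty with rfl | ⟨x₀, -⟩
  · simp
  have : Nonempty X := ⟨x₀⟩
  have hinj : InjOn f s := fun x hx y hy hxy => by
    have := hf x hx y hy
    rw [hxy, dist_self, mul_zero] at this
    exact dist_le_zero.1 this
  have hlip : LipschitzOnWith c (Function.invFunOn f s) (f '' s) := by
    refine LipschitzOnWith.of_dist_le_mul ?_
    rintro _ ⟨x, hx, rfl⟩ _ ⟨y, hy, rfl⟩
    rw [hinj.leftInvOn_invFunOn hx, hinj.leftInvOn_invFunOn hy]
    exact hf x hx y hy
  have := euclideanHausdorffMeasure_image_le hlip d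
  rwa [hinj.leftInvOn_invFunOn.image_image] at this

end Lipschitz

/-- Two measures are comparable as soon as they are comparable on sets of small diameter. -/
lemma measure_le_mul_of_forall_subset_closedBall {X : Type*} [PseudoMetricSpace X]
    [TopologicalSpace.SeparableSpace X] [MeasurableSpace X] [OpensMeasurableSpace X]
    {μ ν : Measure X} {c : ℝ≥0∞} {ε : ℝ} (hε : 0 < ε)
    (h : ∀ x, ∀ ω ⊆ closedBall x ε, MeasurableSet ω → μ ω ≤ c * ν ω) {ω : Set X}
    (hω : MeasurableSet ω) : μ ω ≤ c * ν ω := by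
  rcases isEmpty_or_nonempty X with hX | hX
  · rw [eq_empty_of_isEmpty ω]
    simp
  -- Balls around a dense sequence, made disjoint, give a countable measurable partition into small
  -- pieces.
  set D : ℕ → Set X := disjointed fun k => ball (TopologicalSpace.denseSeq X k) ε with hD
  have hDm : ∀ k, MeasurableSet (D k) :=
    MeasurableSet.disjointed fun k => measurableSet_ball
  have hcover : ⋃ k, D k = univ := by
    rw [hD, iUnion_disjointed, eq_univ_iff_forall]
    intro x
    obtain ⟨k, hk⟩ := (TopologicalSpace.denseRange_denseSeq X).exists_dist_lt x hε
    exact mem_iUnion.2 ⟨k, hk⟩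
  have hsplit : ∀ ρ : Measure X, ρ ω = ∑' k, ρ (ω ∩ D k) := fun ρ => by
    rw [← measure_iUnion (fun i j hij => (disjoint_disjointed _ hij).mono
      inter_subset_right inter_subset_right) fun k => hω.inter (hDm k), ← inter_iUnion, hcover,
      inter_univ]
  rw [hsplit μ, hsplit ν, ← ENNReal.tsum_mul_left]
  exact ENNReal.tsum_le_tsum fun k => h _ _ (inter_subset_right.trans
    ((disjointed_subset _ k).trans ball_subset_closedBall)) (hω.inter (hDm k))

/-- Let `c` decrease to `1`. An infinite `b` is allowed because the limit of the first factor is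
nonzero. -/
lemma le_of_forall_one_lt_le_pow_mul {a b : ℝ≥0∞} {d : ℕ}
    (h : ∀ c : ℝ≥0, 1 < c → a ≤ (c : ℝ≥0∞) ^ d * b) : a ≤ b := by
  have ht : Tendsto (fun c : ℝ≥0 => (c : ℝ≥0∞) ^ d * b) (𝓝[>] 1) (𝓝 (1 * b)) := by
    refine ENNReal.Tendsto.mul_const ?_ (Or.inl one_ne_zero)
    have : Continuous fun c : ℝ≥0 => (c : ℝ≥0∞) ^ d :=
      (ENNReal.continuous_pow d).comp ENNReal.continuous_coe
    have h1 := this.tendsto 1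
    rw [ENNReal.coe_one, one_pow] at h1
    exact h1.mono_left nhdsWithin_le_nhds
  rw [one_mul] at ht
  exact ge_of_tendsto ht (eventually_mem_nhdsWithin.mono h)

/-! ### Flattening a boundary patch -/

/-- The map which flattens the boundary of `K` onto its supporting hyperplane with normal `u`,
extended by homogeneity. -/
noncomputable def flatten (K : Set (EuclideanSpace ℝ (Fin n))) (u z : EuclideanSpace ℝ (Fin n)) :
    EuclideanSpace ℝ (Fin n) :=
  z + (supportFn K u * gauge K z - inner ℝ z u) • u

/-- The smooth boundary points of `K` whose normal lies in `ω`. -/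
def smoothBoundaryWithNormal (K : Set (EuclideanSpace ℝ (Fin n)))
    (ω : Set (sphere (0 : EuclideanSpace ℝ (Fin n)) 1)) : Set (EuclideanSpace ℝ (Fin n)) :=
  Subtype.val '' (sphericalImage K ⁻¹' ω)

namespace IsCenteredBody

lemma gauge_of_mem_segmentCone (hK : IsCenteredBody K)
    {ω : Set (sphere (0 : EuclideanSpace ℝ (Fin n)) 1)} {z : EuclideanSpace ℝ (Fin n)}
    (hz : z ∈ segmentCone (smoothBoundaryWithNormal K ω)) :
    0 < gauge K z ∧ gauge K z ≤ 1 ∧ ∃ y : smoothBoundary K, sphericalImage K y ∈ ω ∧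
      z = gauge K z • (y : EuclideanSpace ℝ (Fin n)) := by
  obtain ⟨t, ht, _, ⟨y, hy, rfl⟩, rfl⟩ := hz
  have h1 := hK.gauge_eq_one_iff.2 (smoothBoundary_subset_frontier y.2)
  have h2 : gauge K (t • (y : EuclideanSpace ℝ (Fin n))) = t := by
    rw [hK.gauge_smul ht.1.le, h1, mul_one]
  rw [h2]
  exact ⟨ht.1, ht.2, y, hy, rfl⟩

lemma flatten_smul (hK : IsCenteredBody K) (u : EuclideanSpace ℝ (Fin n)) {t : ℝ} (ht : 0 ≤ t)
    (z : EuclideanSpace ℝ (Fin n)) : flatten K u (t • z) = t • flatten K u z := by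
  simp only [flatten, hK.gauge_smul ht, inner_smul_left, conj_trivial, smul_add, smul_smul]
  congr 2
  ring

lemma continuous_flatten (hK : IsCenteredBody K) (u : EuclideanSpace ℝ (Fin n)) :
    Continuous (flatten K u) := by
  have := hK.continuous_gauge
  unfold flatten
  fun_prop

lemma measurableSet_smoothBoundaryWithNormal (hK : IsCenteredBody K)
    {ω : Set (sphere (0 : EuclideanSpace ℝ (Fin n)) 1)} (hω : MeasurableSet ω) :
    MeasurableSet (smoothBoundaryWithNormal K ω) :=
  hK.measurableSet_smoothBoundary.subtype_image (hK.continuous_sphericalImage.measurable hω)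

lemma surfaceAreaMeasure_apply (hK : IsCenteredBody K)
    {ω : Set (sphere (0 : EuclideanSpace ℝ (Fin n)) 1)} (hω : MeasurableSet ω) :
    surfaceAreaMeasure K ω =
      Measure.euclideanHausdorffMeasure (n - 1) (smoothBoundaryWithNormal K ω) := by
  rw [surfaceAreaMeasure, Measure.map_apply hK.continuous_sphericalImage.measurable hω,
    comap_subtype_coe_apply hK.measurableSet_smoothBoundary]
  rfl

/-- The normal at a smooth boundary point, suitably scaled, is a subgradient of the gauge. -/
lemma inner_sub_le_gauge_sub (hK : IsCenteredBody K)
    {ω : Set (sphere (0 : EuclideanSpace ℝ (Fin n)) 1)} {w : EuclideanSpace ℝ (Fin n)}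
    (hw : w ∈ segmentCone (smoothBoundaryWithNormal K ω)) :
    ∃ v ∈ ω, ∀ z, inner ℝ (z - w) (v : EuclideanSpace ℝ (Fin n)) ≤
      supportFn K v * (gauge K z - gauge K w) := by
  obtain ⟨h0, -, y, hy, hwy⟩ := hK.gauge_of_mem_segmentCone hw
  refine ⟨_, hy, fun z => ?_⟩
  have h1 := hK.inner_le_supportFn_mul_gauge z (sphericalImage K y)
  have h2 := (isUnitNormal_sphericalImage y).2
  have h3 : inner ℝ w (sphericalImage K y : EuclideanSpace ℝ (Fin n)) =
      gauge K w * supportFn K (sphericalImage K y) := by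
    conv_lhs => rw [hwy]
    rw [inner_smul_left, h2]
    simp
  rw [inner_sub_left, h3]
  linarith

/-- The subgradient inequality at `w`, with normal `v ∈ ω`, is scaled by `q = h_K(u)/h_K(v)`,
leaving at most `⟨z - w, u - q v⟩`. Since `h_K` is `R`-Lipschitz and at least `r` on the sphere, `|1
- q| ≤ (R/r) ε`. Only `w` has to lie in the cone, so exchanging the points bounds the other sign. -/
lemma flatten_defect_le (hK : IsCenteredBody K) {r R ε : ℝ} (hr : 0 < r)
    (hrK : closedBall (0 : EuclideanSpace ℝ (Fin n)) r ⊆ K) (hR : ∀ x ∈ K, ‖x‖ ≤ R)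
    {u : sphere (0 : EuclideanSpace ℝ (Fin n)) 1}
    {ω : Set (sphere (0 : EuclideanSpace ℝ (Fin n)) 1)} (hω : ω ⊆ closedBall u ε)
    {w : EuclideanSpace ℝ (Fin n)} (hw : w ∈ segmentCone (smoothBoundaryWithNormal K ω))
    (z : EuclideanSpace ℝ (Fin n)) :
    inner ℝ (z - w) (u : EuclideanSpace ℝ (Fin n)) - supportFn K u * (gauge K z - gauge K w) ≤
      (R / r + 1) * ε * ‖z - w‖ := by
  obtain ⟨v, hv, h⟩ := hK.inner_sub_le_gauge_sub hw
  have hvu : ‖(u : EuclideanSpace ℝ (Fin n)) - v‖ ≤ ε := by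
    rw [← dist_eq_norm, dist_comm]; exact hω hv
  have hR0 : 0 ≤ R := (norm_nonneg _).trans (hR 0 hK.zero_mem)
  have hhv := hK.supportFn_pos_of_sphere v
  have hhu := hK.supportFn_pos_of_sphere u
  have hrv : r ≤ supportFn K v := by
    simpa using hK.mul_norm_le_supportFn hr hrK (v : EuclideanSpace ℝ (Fin n))
  set q := supportFn K u / supportFn K v with hq
  have hq1 : |1 - q| ≤ R / r * ε := by
    have h1 := hK.abs_supportFn_sub_le hR v u
    rw [norm_sub_rev] at h1
    have : 1 - q = (supportFn K v - supportFn K u) / supportFn K v := by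
      rw [hq]; field_simp
    rw [this, abs_div, abs_of_pos hhv, div_le_iff₀ hhv]
    calc _ ≤ R * ε := h1.trans (by gcongr)
      _ = R / r * ε * r := by field_simp
      _ ≤ _ := by
        have : 0 ≤ ε := (norm_nonneg _).trans hvu
        gcongr
  have h2 : q * inner ℝ (z - w) (v : EuclideanSpace ℝ (Fin n)) ≤
      supportFn K u * (gauge K z - gauge K w) := by
    calc _ ≤ q * (supportFn K v * (gauge K z - gauge K w)) := by
          have : 0 ≤ q := by positivity
          gcongr
          exact h z
      _ = _ := by rw [hq]; field_simp
  have h3 : inner ℝ (z - w) ((u : EuclideanSpace ℝ (Fin n)) - q • (v : EuclideanSpace ℝ (Fin n))) ≤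
      ‖z - w‖ * ((R / r + 1) * ε) := by
    refine (real_inner_le_norm _ _).trans ?_
    gcongr
    calc ‖(u : EuclideanSpace ℝ (Fin n)) - q • (v : EuclideanSpace ℝ (Fin n))‖
        = ‖((u : EuclideanSpace ℝ (Fin n)) - v) + (1 - q) • (v : EuclideanSpace ℝ (Fin n))‖ := by
          congr 1; module
      _ ≤ ε + R / r * ε := by
          refine (norm_add_le _ _).trans (add_le_add hvu ?_)
          rw [norm_smul, norm_eq_of_mem_sphere, mul_one]
          exact hq1
      _ = _ := by ring
  rw [inner_sub_right, inner_smul_right] at h3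
  linarith

lemma abs_norm_flatten_sub (hK : IsCenteredBody K) {r R ε : ℝ} (hr : 0 < r)
    (hrK : closedBall (0 : EuclideanSpace ℝ (Fin n)) r ⊆ K) (hR : ∀ x ∈ K, ‖x‖ ≤ R)
    {u : sphere (0 : EuclideanSpace ℝ (Fin n)) 1}
    {ω : Set (sphere (0 : EuclideanSpace ℝ (Fin n)) 1)} (hω : ω ⊆ closedBall u ε)
    {z w : EuclideanSpace ℝ (Fin n)} (hz : z ∈ segmentCone (smoothBoundaryWithNormal K ω))
    (hw : w ∈ segmentCone (smoothBoundaryWithNormal K ω)) :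
    |‖flatten K u z - flatten K u w‖ - ‖z - w‖| ≤ (R / r + 1) * ε * ‖z - w‖ := by
  have h1 := hK.flatten_defect_le hr hrK hR hω hw z
  have h2 := hK.flatten_defect_le hr hrK hR hω hz w
  rw [norm_sub_rev w z] at h2
  refine (abs_norm_sub_norm_le _ _).trans ?_
  have : flatten K u z - flatten K u w - (z - w) =
      (supportFn K u * (gauge K z - gauge K w) -
        inner ℝ (z - w) (u : EuclideanSpace ℝ (Fin n))) • (u : EuclideanSpace ℝ (Fin n)) := by
    simp only [flatten, inner_sub_left]
    module
  rw [this, norm_smul, norm_eq_of_mem_sphere, mul_one, Real.norm_eq_abs, abs_le]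
  have h3 : inner ℝ (w - z) (u : EuclideanSpace ℝ (Fin n)) =
      - inner ℝ (z - w) (u : EuclideanSpace ℝ (Fin n)) := by
    rw [← inner_neg_left, neg_sub]
  constructor <;> linarith

lemma flatten_image_segmentCone (hK : IsCenteredBody K) (u : EuclideanSpace ℝ (Fin n))
    (A : Set (EuclideanSpace ℝ (Fin n))) :
    flatten K u '' segmentCone A = segmentCone (flatten K u '' A) := by
  ext z
  constructor
  · rintro ⟨_, ⟨t, ht, x, hx, rfl⟩, rfl⟩
    exact ⟨t, ht, _, mem_image_of_mem _ hx, hK.flatten_smul u ht.1.le x⟩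
  · rintro ⟨t, ht, _, ⟨x, hx, rfl⟩, rfl⟩
    exact ⟨_, ⟨t, ht, x, hx, rfl⟩, hK.flatten_smul u ht.1.le x⟩

end IsCenteredBody

lemma subset_segmentCone (A : Set (EuclideanSpace ℝ (Fin n))) : A ⊆ segmentCone A :=
  fun x hx => ⟨1, ⟨one_pos, le_rfl⟩, x, hx, (one_smul _ _).symm⟩

/-! ### Cone volume measure as a law of normals -/

namespace IsCenteredBody

/-- Over a small set of normals the flattening is `c`-bi-Lipschitz. Passing to the flat cone costs
`c^n` in volume and `c^(n-1)` in area, and freezing `h_K` at `u` costs `c`; together these make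
`c^(2n)`. -/
lemma volume_segmentCone_comparison (hK : IsCenteredBody K) (hn : 1 ≤ n) {c : ℝ≥0} (hc : 1 < c) :
    ∃ ε > 0, ∀ u : sphere (0 : EuclideanSpace ℝ (Fin n)) 1, ∀ ω ⊆ closedBall u ε,
      MeasurableSet ω →
      volume (segmentCone (smoothBoundaryWithNormal K ω)) ≤
        (c : ℝ≥0∞) ^ (2 * n) * coneVolumeMeasure K ω ∧
      coneVolumeMeasure K ω ≤
        (c : ℝ≥0∞) ^ (2 * n) * volume (segmentCone (smoothBoundaryWithNormal K ω)) := by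
  obtain ⟨r, hr, hrK⟩ := hK.exists_closedBall_subset
  obtain ⟨R, hR0, hR⟩ := hK.exists_norm_le
  have hc' : (1 : ℝ) < c := by exact_mod_cast hc
  have hcpos : (0 : ℝ) < c := by linarith
  -- With this choice `1 - δ = 1/c` and `1 + δ ≤ c`, so one `δ` controls both the flattening and its
  -- inverse.
  set δ : ℝ := 1 - 1 / c with hδ
  have hδ0 : 0 < δ := by rw [hδ, sub_pos, div_lt_one hcpos]; exact hc'
  have hδc : 1 + δ ≤ c := by
    have : (c : ℝ) - (1 + δ) = (c - 1) ^ 2 / c := by rw [hδ]; field_simp; ring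
    have h2 : 0 ≤ (c - 1 : ℝ) ^ 2 / c := by positivity
    linarith
  have hδc' : c * (1 - δ) = 1 := by rw [hδ]; field_simp; ring
  have hRr : 0 < R / r + 1 := by positivity
  set ε := δ / (R / r + 1) with hε
  have hε0 : 0 < ε := by positivity
  have hεδ : (R / r + 1) * ε = δ := by rw [hε]; field_simp
  refine ⟨ε, hε0, fun u ω hω hωm => ?_⟩
  set A := smoothBoundaryWithNormal K ω with hA
  set Ψ := flatten K (u : EuclideanSpace ℝ (Fin n)) with hΨ
  have hAm : MeasurableSet A := hK.measurableSet_smoothBoundaryWithNormal hωm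
  have hbi : ∀ z ∈ segmentCone A, ∀ w ∈ segmentCone A,
      |‖Ψ z - Ψ w‖ - ‖z - w‖| ≤ δ * ‖z - w‖ := fun z hz w hw => by
    rw [← hεδ]; exact hK.abs_norm_flatten_sub hr hrK hR hω hz hw
  have hlip : LipschitzOnWith c Ψ (segmentCone A) := by
    refine LipschitzOnWith.of_dist_le_mul fun z hz w hw => ?_
    rw [dist_eq_norm, dist_eq_norm]
    have := (abs_le.1 (hbi z hz w hw)).2
    nlinarith [norm_nonneg (z - w)]
  have hanti : ∀ z ∈ segmentCone A, ∀ w ∈ segmentCone A, dist z w ≤ c * dist (Ψ z) (Ψ w) := by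
    intro z hz w hw
    rw [dist_eq_norm, dist_eq_norm]
    have := (abs_le.1 (hbi z hz w hw)).1
    calc ‖z - w‖ = c * ((1 - δ) * ‖z - w‖) := by rw [← mul_assoc, hδc', one_mul]
      _ ≤ _ := by gcongr; linarith
  have hsub := subset_segmentCone A
  have hinj : InjOn Ψ A := fun x hx y hy hxy => by
    have := hanti x (hsub hx) y (hsub hy)
    rw [hxy, dist_self, mul_zero] at this
    exact dist_le_zero.1 this
  set F := Ψ '' A with hF
  have hFm : MeasurableSet F :=
    hAm.image_of_continuousOn_injOn (hK.continuous_flatten _).continuousOn hinj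
  have hflat : ∀ x ∈ F, inner ℝ x (u : EuclideanSpace ℝ (Fin n)) = supportFn K u := by
    rintro _ ⟨_, ⟨y, hy, rfl⟩, rfl⟩
    have h1 := hK.gauge_eq_one_iff.2 (smoothBoundary_subset_frontier y.2)
    simp only [hΨ, flatten, inner_add_left, inner_smul_left, real_inner_self_eq_norm_sq,
      norm_eq_of_mem_sphere, h1, conj_trivial]
    ring
  have hhu := hK.supportFn_pos_of_sphere u
  have hcone := volume_segmentCone_of_flat hn (norm_eq_of_mem_sphere u) hhu hFm hflat
  have hcF : Ψ '' segmentCone A = segmentCone F := hK.flatten_image_segmentCone _ A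
  -- Regarding Lebesgue measure as Hausdorff measure lets the Lipschitz bounds act on the solid
  -- cones too.
  have hE : (volume : Measure (EuclideanSpace ℝ (Fin n))) = Measure.euclideanHausdorffMeasure n :=
    (EuclideanSpace.euclideanHausdorffMeasure_eq_volume n).symm
  have hv1 : volume (segmentCone A) ≤ (c : ℝ≥0∞) ^ n * volume (segmentCone F) := by
    rw [hE, ← hcF]
    exact euclideanHausdorffMeasure_le_image hanti n
  have hv2 : volume (segmentCone F) ≤ (c : ℝ≥0∞) ^ n * volume (segmentCone A) := by
    rw [hE, ← hcF]
    exact euclideanHausdorffMeasure_image_le hlip n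
  have hs1 : Measure.euclideanHausdorffMeasure (n - 1) A ≤
      (c : ℝ≥0∞) ^ (n - 1) * Measure.euclideanHausdorffMeasure (n - 1) F :=
    euclideanHausdorffMeasure_le_image (fun x hx y hy => hanti x (hsub hx) y (hsub hy)) _
  have hs2 : Measure.euclideanHausdorffMeasure (n - 1) F ≤
      (c : ℝ≥0∞) ^ (n - 1) * Measure.euclideanHausdorffMeasure (n - 1) A :=
    euclideanHausdorffMeasure_image_le (hlip.mono hsub) _
  have hsurf : Measure.euclideanHausdorffMeasure (n - 1) A = surfaceAreaMeasure K ω :=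
    (hK.surfaceAreaMeasure_apply hωm).symm
  have hsupp : ∀ v w : sphere (0 : EuclideanSpace ℝ (Fin n)) 1, dist v w ≤ ε →
      supportFn K v ≤ c * supportFn K w := by
    intro v w hvw
    have h1 := hK.supportFn_sub_le hR (v : EuclideanSpace ℝ (Fin n)) w
    have h2 : ‖(v : EuclideanSpace ℝ (Fin n)) - w‖ ≤ ε := by rwa [← dist_eq_norm]
    have hrw : r ≤ supportFn K w := by
      simpa using hK.mul_norm_le_supportFn hr hrK (w : EuclideanSpace ℝ (Fin n))
    have h3 : R * ε ≤ δ * supportFn K w := by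
      calc R * ε = R / r * ε * r := by field_simp
        _ ≤ ((R / r + 1) * ε) * supportFn K w := by gcongr; linarith
        _ = _ := by rw [hεδ]
    have h4 : R * ‖(v : EuclideanSpace ℝ (Fin n)) - w‖ ≤ R * ε := by gcongr
    nlinarith
  have hwd : coneVolumeMeasure K ω = ∫⁻ v in ω,
      ENNReal.ofReal (1 / (n : ℝ) * supportFn K (v : EuclideanSpace ℝ (Fin n)))
        ∂(surfaceAreaMeasure K) := withDensity_apply _ hωm
  have hcofReal : (c : ℝ≥0∞) = ENNReal.ofReal c := by simp
  have hd1 : coneVolumeMeasure K ω ≤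
      c * (ENNReal.ofReal (supportFn K u / n) * surfaceAreaMeasure K ω) := by
    rw [hwd, ← mul_assoc, ← setLIntegral_const]
    refine setLIntegral_mono measurable_const fun v hv => ?_
    rw [hcofReal, ← ENNReal.ofReal_mul hcpos.le]
    refine ENNReal.ofReal_le_ofReal ?_
    rw [one_div_mul_eq_div, mul_div_assoc']
    gcongr
    exact hsupp v u (hω hv)
  have hd2 : ENNReal.ofReal (supportFn K u / n) * surfaceAreaMeasure K ω ≤
      c * coneVolumeMeasure K ω := by
    have hmeas : Measurable fun v : sphere (0 : EuclideanSpace ℝ (Fin n)) 1 =>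
        ENNReal.ofReal (1 / (n : ℝ) * supportFn K (v : EuclideanSpace ℝ (Fin n))) :=
      ((hK.continuous_supportFn.comp continuous_subtype_val).measurable.const_mul _).ennreal_ofReal
    rw [hwd, ← lintegral_const_mul _ hmeas, ← setLIntegral_const]
    refine setLIntegral_mono (hmeas.const_mul _) fun v hv => ?_
    rw [hcofReal, ← ENNReal.ofReal_mul hcpos.le]
    refine ENNReal.ofReal_le_ofReal ?_
    rw [one_div_mul_eq_div, mul_div_assoc']
    gcongr
    exact hsupp u v (by rw [dist_comm]; exact hω hv)
  rw [hsurf] at hs1 hs2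
  have hpow : (c : ℝ≥0∞) ^ (2 * n) = c ^ n * c ^ (n - 1) * c := by
    rw [mul_assoc, ← pow_succ, Nat.sub_add_cancel hn, two_mul, pow_add]
  rw [hpow]
  constructor
  · calc volume (segmentCone A) ≤ c ^ n * volume (segmentCone F) := hv1
      _ = c ^ n * (ENNReal.ofReal (supportFn K u / n) *
            Measure.euclideanHausdorffMeasure (n - 1) F) := by rw [hcone]
      _ ≤ c ^ n * (ENNReal.ofReal (supportFn K u / n) *
            (c ^ (n - 1) * surfaceAreaMeasure K ω)) := by gcongr
      _ = c ^ n * c ^ (n - 1) * (ENNReal.ofReal (supportFn K u / n) *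
            surfaceAreaMeasure K ω) := by ring
      _ ≤ c ^ n * c ^ (n - 1) * (c * coneVolumeMeasure K ω) := by gcongr
      _ = _ := by ring
  · calc coneVolumeMeasure K ω
        ≤ c * (ENNReal.ofReal (supportFn K u / n) * surfaceAreaMeasure K ω) := hd1
      _ ≤ c * (ENNReal.ofReal (supportFn K u / n) *
            (c ^ (n - 1) * Measure.euclideanHausdorffMeasure (n - 1) F)) := by gcongr
      _ = c * c ^ (n - 1) * (ENNReal.ofReal (supportFn K u / n) *
            Measure.euclideanHausdorffMeasure (n - 1) F) := by ring
      _ = c * c ^ (n - 1) * volume (segmentCone F) := by rw [hcone]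
      _ ≤ c * c ^ (n - 1) * (c ^ n * volume (segmentCone A)) := by gcongr
      _ = _ := by ring

/-- Off the null set where the radial projection is not smooth, `x = g_K(x) y` with `y` its
projection, and `x ∈ K` means `g_K(x) ≤ 1`. -/
lemma map_coneNormal_apply (hK : IsCenteredBody K) (hn : 1 ≤ n)
    (u₀ : sphere (0 : EuclideanSpace ℝ (Fin n)) 1)
    {ω : Set (sphere (0 : EuclideanSpace ℝ (Fin n)) 1)} (hω : MeasurableSet ω) :
    (volume.restrict K).map (coneNormal K u₀) ω =
      volume (segmentCone (smoothBoundaryWithNormal K ω)) := by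
  have hm := hK.measurable_coneNormal u₀
  rw [Measure.map_apply hm hω, Measure.restrict_apply (hm hω)]
  refine measure_congr ?_
  filter_upwards [hK.ae_mem_smoothBoundary hn] with x hx
  obtain ⟨hx0, hx⟩ := hx
  have hg := hK.gauge_pos hx0
  refine propext ⟨fun h => ?_, fun h => ?_⟩
  · obtain ⟨h1, h2⟩ := (h : x ∈ _ ∩ K)
    rw [mem_preimage, coneNormal_of_mem hx] at h1
    exact ⟨gauge K x, ⟨hg, hK.gauge_le_one_iff.2 h2⟩, _, ⟨⟨_, hx⟩, h1, rfl⟩, by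
      rw [smul_smul, mul_inv_cancel₀ hg.ne', one_smul]⟩
  · obtain ⟨-, h2, y, hy, hxy⟩ := hK.gauge_of_mem_segmentCone h
    refine ⟨?_, hK.gauge_le_one_iff.1 h2⟩
    rw [mem_preimage, coneNormal_of_mem hx]
    have : (⟨_, hx⟩ : smoothBoundary K) = y := by
      refine Subtype.ext ?_
      change (gauge K x)⁻¹ • x = y
      conv_lhs => rw [hxy]
      rw [hK.gauge_smul hg.le, hK.gauge_eq_one_iff.2 (smoothBoundary_subset_frontier y.2), mul_one,
        smul_smul, inv_mul_cancel₀ hg.ne', one_smul]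
    rw [this]
    exact hy

/-- The cone volume measure is the distribution of the normal at the radial projection of a point
of the body. -/
theorem coneVolumeMeasure_eq_map (hK : IsCenteredBody K) (hn : 1 ≤ n)
    (u₀ : sphere (0 : EuclideanSpace ℝ (Fin n)) 1) :
    coneVolumeMeasure K = (volume.restrict K).map (coneNormal K u₀) := by
  ext ω hω
  refine le_antisymm ?_ ?_
  · refine le_of_forall_one_lt_le_pow_mul (d := 2 * n) fun c hc => ?_
    obtain ⟨ε, hε, h⟩ := hK.volume_segmentCone_comparison hn hc
    refine measure_le_mul_of_forall_subset_closedBall hε (fun u ω' hω' hm => ?_) hω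
    rw [hK.map_coneNormal_apply hn u₀ hm]
    exact (h u ω' hω' hm).2
  · refine le_of_forall_one_lt_le_pow_mul (d := 2 * n) fun c hc => ?_
    obtain ⟨ε, hε, h⟩ := hK.volume_segmentCone_comparison hn hc
    refine measure_le_mul_of_forall_subset_closedBall hε (fun u ω' hω' hm => ?_) hω
    rw [hK.map_coneNormal_apply hn u₀ hm]
    exact (h u ω' hω' hm).1

end IsCenteredBody

/-! ### Volumes in polar coordinates -/

/-- Polar coordinates on the open unit ball of a positively homogeneous function `f`, for
integrands which are constant on rays. -/
lemma lintegral_lt_one_of_homogeneous (hn : 1 ≤ n) {f : EuclideanSpace ℝ (Fin n) → ℝ}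
    (hf : Measurable f) (hf_smul : ∀ t > 0, ∀ x, f (t • x) = t * f x)
    (hf_pos : ∀ x ≠ 0, 0 < f x) {F : EuclideanSpace ℝ (Fin n) → ℝ≥0∞} (hF : Measurable F)
    (hF_smul : ∀ t > (0 : ℝ), ∀ x, F (t • x) = F x) :
    ∫⁻ x in {x | f x < 1}, F x =
      ∫⁻ u : sphere (0 : EuclideanSpace ℝ (Fin n)) 1, F u * ENNReal.ofReal ((1 / f u) ^ n / n)
        ∂(volume : Measure (EuclideanSpace ℝ (Fin n))).toSphere := by
  have : Nonempty (Fin n) := ⟨⟨0, hn⟩⟩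
  have hm : MeasurableSet {x | f x < 1} := measurableSet_lt hf measurable_const
  set H := ({x | f x < 1}).indicator F with hH
  have hHm : Measurable H := hF.indicator hm
  have hGm : Measurable fun p : sphere (0 : EuclideanSpace ℝ (Fin n)) 1 × Ioi (0 : ℝ) =>
      H ((p.2 : ℝ) • (p.1 : EuclideanSpace ℝ (Fin n))) :=
    hHm.comp (by fun_prop)
  rw [← lintegral_indicator hm, ← hH]
  have h1 : ∫⁻ x, H x = ∫⁻ x : ({0}ᶜ : Set (EuclideanSpace ℝ (Fin n))), H (x : _)
      ∂(Measure.comap Subtype.val volume) := by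
    rw [lintegral_subtype_comap (measurableSet_singleton _).compl, restrict_compl_singleton]
  have h2 := (volume : Measure (EuclideanSpace ℝ (Fin n))).measurePreserving_homeomorphUnitSphereProd
    |>.lintegral_comp_emb (Homeomorph.measurableEmbedding _)
      (fun p => H ((p.2 : ℝ) • (p.1 : EuclideanSpace ℝ (Fin n))))
  have h3 : ∀ x : ({0}ᶜ : Set (EuclideanSpace ℝ (Fin n))),
      H ((((homeomorphUnitSphereProd (EuclideanSpace ℝ (Fin n))) x).2 : ℝ) •
        (((homeomorphUnitSphereProd (EuclideanSpace ℝ (Fin n))) x).1 :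
          EuclideanSpace ℝ (Fin n))) = H x := by
    intro x
    have hx : ‖(x : EuclideanSpace ℝ (Fin n))‖ ≠ 0 := norm_ne_zero_iff.2 x.2
    congr 1
    simp [smul_smul, hx]
  simp_rw [h3] at h2
  rw [h1, h2, lintegral_prod _ hGm.aemeasurable]
  refine lintegral_congr fun u => ?_
  have hfu := hf_pos u (ne_zero_of_mem_unit_sphere u)
  -- Along the ray through `u` the integrand is constant up to radius `1 / f u` and then zero; the
  -- weight `r^(n-1)` gives `(1 / f u)^n / n`.
  have h4 : ∀ r : Ioi (0 : ℝ), H ((r : ℝ) • (u : EuclideanSpace ℝ (Fin n))) =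
      (Iio (⟨1 / f u, one_div_pos.2 hfu⟩ : Ioi (0 : ℝ))).indicator (fun _ => F u) r := by
    intro r
    have hiff : (r : ℝ) • (u : EuclideanSpace ℝ (Fin n)) ∈ {x | f x < 1} ↔
        r ∈ Iio (⟨1 / f u, one_div_pos.2 hfu⟩ : Ioi (0 : ℝ)) := by
      rw [mem_ofPred_eq, hf_smul _ r.2, mem_Iio, ← Subtype.coe_lt_coe, lt_div_iff₀ hfu]
    by_cases hr : r ∈ Iio (⟨1 / f u, one_div_pos.2 hfu⟩ : Ioi (0 : ℝ))
    · rw [indicator_of_mem hr, hH, indicator_of_mem (hiff.2 hr), hF_smul _ r.2]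
    · rw [indicator_of_notMem hr, hH, indicator_of_notMem (fun h => hr (hiff.1 h))]
  simp_rw [h4]
  rw [lintegral_indicator measurableSet_Iio, setLIntegral_const,
    Measure.volumeIoiPow_apply_Iio]
  have hd : Module.finrank ℝ (EuclideanSpace ℝ (Fin n)) - 1 + 1 = n := by
    rw [finrank_euclideanSpace_fin, Nat.sub_add_cancel hn]
  rw [hd]
  congr 4
  rw [finrank_euclideanSpace_fin, Nat.cast_sub hn]
  simp

namespace IsCenteredBody

lemma ae_eq_gauge_lt_one (hK : IsCenteredBody K) :
    K =ᵐ[volume] {x | gauge K x < 1} := by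
  rw [setOfPred_gauge_lt_one_eq_interior hK.convex hK.mem_nhds]
  exact (interior_ae_eq_of_null_frontier (hK.convex.addHaar_frontier volume)).symm

/-- The volume of `L` as an integral over `K`. -/
lemma volume_eq_lintegral_gauge_div (hK : IsCenteredBody K) (hL : IsCenteredBody L) (hn : 1 ≤ n) :
    volume L = ∫⁻ x in K, ENNReal.ofReal ((gauge K x / gauge L x) ^ n) := by
  have hmK := hK.continuous_gauge.measurable
  have hmL := hL.continuous_gauge.measurable
  -- Both integrals become spherical, and in each direction `(g_K/g_L)^n · g_K^(-n) = g_L^(-n)`.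
  have h1 := lintegral_lt_one_of_homogeneous hn hmL (fun t ht => hL.gauge_smul ht.le)
    (fun x => hL.gauge_pos) (F := fun _ => 1) measurable_const (fun _ _ _ => rfl)
  have h2 := lintegral_lt_one_of_homogeneous hn hmK (fun t ht => hK.gauge_smul ht.le)
    (fun x => hK.gauge_pos) (F := fun x => ENNReal.ofReal ((gauge K x / gauge L x) ^ n))
    ((hmK.div hmL).pow_const n).ennreal_ofReal (fun t ht x => by
      rw [hK.gauge_smul ht.le, hL.gauge_smul ht.le, mul_div_mul_left _ _ ht.ne'])
  rw [Measure.restrict_congr_set hK.ae_eq_gauge_lt_one, h2, measure_congr hL.ae_eq_gauge_lt_one,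
    ← setLIntegral_one, h1]
  refine lintegral_congr fun u => ?_
  have hu := ne_zero_of_mem_unit_sphere u
  have hk := hK.gauge_pos hu
  have hl := hL.gauge_pos hu
  rw [one_mul, ← ENNReal.ofReal_mul (by positivity)]
  congr 1
  rw [mul_div_assoc', ← mul_pow]
  congr 2
  field_simp

end IsCenteredBody

/-! ### Gauges of `L₀`-sums to first order -/

/-- The logarithm of the quotient of the support functions. -/
noncomputable def logRatio (K L : Set (EuclideanSpace ℝ (Fin n)))
    (u : sphere (0 : EuclideanSpace ℝ (Fin n)) 1) : ℝ :=
  Real.log (supportFn L u / supportFn K u)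

namespace IsCenteredBody

lemma continuous_logRatio (hK : IsCenteredBody K) (hL : IsCenteredBody L) :
    Continuous (logRatio K L) := by
  refine Continuous.log ((hL.continuous_supportFn.comp continuous_subtype_val).div
    (hK.continuous_supportFn.comp continuous_subtype_val)
      fun u => (hK.supportFn_pos_of_sphere u).ne') fun u => ?_
  exact (div_pos (hL.supportFn_pos_of_sphere u) (hK.supportFn_pos_of_sphere u)).ne'

lemma exists_abs_logRatio_le (hK : IsCenteredBody K) (hL : IsCenteredBody L) :
    ∃ M > 0, ∀ u, |logRatio K L u| ≤ M := by
  obtain ⟨M, hM⟩ := isCompact_univ.exists_bound_of_continuousOn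
    (hK.continuous_logRatio hL).continuousOn
  exact ⟨max M 1, by positivity, fun u => (hM u (mem_univ u)).trans (le_max_left _ _)⟩

lemma supportFn_rpow_mul_rpow (hK : IsCenteredBody K) (hL : IsCenteredBody L) (t : ℝ)
    (u : sphere (0 : EuclideanSpace ℝ (Fin n)) 1) :
    supportFn K u ^ (1 - t) * supportFn L u ^ t =
      supportFn K u * Real.exp (t * logRatio K L u) := by
  have hk := hK.supportFn_pos_of_sphere u
  have hl := hL.supportFn_pos_of_sphere u
  rw [logRatio, Real.log_div hl.ne' hk.ne', Real.rpow_def_of_pos hk, Real.rpow_def_of_pos hl,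
    ← Real.exp_add]
  conv_rhs => rw [← Real.exp_log hk, Real.log_exp, ← Real.exp_add]
  congr 1
  ring

lemma mem_L0Sum_iff (hK : IsCenteredBody K) (hL : IsCenteredBody L) {t : ℝ}
    {x : EuclideanSpace ℝ (Fin n)} :
    x ∈ L0Sum t K L ↔ ∀ u : sphere (0 : EuclideanSpace ℝ (Fin n)) 1,
      inner ℝ x (u : EuclideanSpace ℝ (Fin n)) ≤
        supportFn K u * Real.exp (t * logRatio K L u) := by
  constructor
  · intro h u
    rw [← hK.supportFn_rpow_mul_rpow hL]
    exact h u u.2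
  · intro h u hu
    have := hK.supportFn_rpow_mul_rpow hL t ⟨u, hu⟩
    exact (h ⟨u, hu⟩).trans this.ge

lemma supportFn_L0Sum_le (hK : IsCenteredBody K) (hL : IsCenteredBody L) {t : ℝ}
    (hQ : IsCenteredBody (L0Sum t K L)) (u : sphere (0 : EuclideanSpace ℝ (Fin n)) 1) :
    supportFn (L0Sum t K L) u ≤ supportFn K u * Real.exp (t * logRatio K L u) :=
  supportFn_le hQ.nonempty fun _ hx => (hK.mem_L0Sum_iff hL).1 hx u

/-- An `L₀`-sum of `L₀`-sums on the segment from `K` to `L` lies in an `L₀`-sum on it. -/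
lemma L0Sum_L0Sum_subset (hK : IsCenteredBody K) (hL : IsCenteredBody L) {s t : ℝ}
    (hQ : IsCenteredBody (L0Sum s K L)) (ht : t ∈ Icc (0 : ℝ) 1) :
    L0Sum t (L0Sum s K L) L ⊆ L0Sum ((1 - t) * s + t) K L := by
  intro x hx
  rw [hK.mem_L0Sum_iff hL]
  intro u
  have hk := hK.supportFn_pos_of_sphere u
  have hl := hL.supportFn_pos_of_sphere u
  have hq := hQ.supportFn_pos_of_sphere u
  refine (hx u u.2).trans ?_
  -- A Wulff shape may have a smaller support function than the function defining it, so only an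
  -- inclusion results.
  have h1 : supportFn (L0Sum s K L) u ^ (1 - t) ≤
      (supportFn K u ^ (1 - s) * supportFn L u ^ s) ^ (1 - t) := by
    rw [hK.supportFn_rpow_mul_rpow hL]
    exact Real.rpow_le_rpow hq.le (hK.supportFn_L0Sum_le hL hQ u) (sub_nonneg.2 ht.2)
  calc _ ≤ (supportFn K u ^ (1 - s) * supportFn L u ^ s) ^ (1 - t) * supportFn L u ^ t := by gcongr
    _ = supportFn K u ^ (1 - ((1 - t) * s + t)) * supportFn L u ^ ((1 - t) * s + t) := by
      rw [Real.mul_rpow (by positivity) (by positivity), ← Real.rpow_mul hk.le,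
        ← Real.rpow_mul hl.le, mul_assoc, ← Real.rpow_add hl]
      congr 2 <;> ring
    _ = _ := hK.supportFn_rpow_mul_rpow hL _ u

/-- Pairing `x` with a normal `v` of `K` is exact for `K`, whereas for the `L₀`-sum it gives only an
upper bound; comparing the two bounds the quotient. -/
lemma gauge_div_gauge_le (hK : IsCenteredBody K) (hL : IsCenteredBody L) {t : ℝ}
    (hQ : IsCenteredBody (L0Sum t K L)) {x : EuclideanSpace ℝ (Fin n)} (hx : x ≠ 0)
    {v : sphere (0 : EuclideanSpace ℝ (Fin n)) 1}
    (hv : inner ℝ x (v : EuclideanSpace ℝ (Fin n)) = supportFn K v * gauge K x) :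
    gauge K x / gauge (L0Sum t K L) x ≤ Real.exp (t * logRatio K L v) := by
  have hq := hQ.gauge_pos hx
  have hk := hK.supportFn_pos_of_sphere v
  have h1 := hQ.inner_le_supportFn_mul_gauge x v
  have h2 := hK.supportFn_L0Sum_le hL hQ v
  rw [div_le_iff₀ hq]
  refine le_of_mul_le_mul_left ?_ hk
  calc supportFn K v * gauge K x ≤ supportFn (L0Sum t K L) v * gauge (L0Sum t K L) x := by
        rw [← hv]; exact h1
    _ ≤ supportFn K v * Real.exp (t * logRatio K L v) * gauge (L0Sum t K L) x := by gcongr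
    _ = _ := by ring

/-- Take `u` maximising `⟨x, u⟩` over the Wulff function, i.e. the constraint active on the ray
through `x`. The maximum is positive, as the direction of `x` shows, and dividing `x` by it gives a
point of the `L₀`-sum. -/
lemma exists_gauge_L0Sum_mul_le (hK : IsCenteredBody K) (hL : IsCenteredBody L) {t : ℝ}
    (hQ : IsCenteredBody (L0Sum t K L)) {x : EuclideanSpace ℝ (Fin n)} (hx : x ≠ 0) :
    ∃ u : sphere (0 : EuclideanSpace ℝ (Fin n)) 1,
      gauge (L0Sum t K L) x * (supportFn K u * Real.exp (t * logRatio K L u)) ≤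
        inner ℝ x (u : EuclideanSpace ℝ (Fin n)) := by
  have hxn : 0 < ‖x‖ := norm_pos_iff.2 hx
  set u₁ : sphere (0 : EuclideanSpace ℝ (Fin n)) 1 :=
    ⟨‖x‖⁻¹ • x, by simp [norm_smul, hxn.ne']⟩ with hu₁
  set φ : sphere (0 : EuclideanSpace ℝ (Fin n)) 1 → ℝ := fun u =>
    inner ℝ x (u : EuclideanSpace ℝ (Fin n)) / (supportFn K u * Real.exp (t * logRatio K L u))
    with hφ
  have hden : ∀ u : sphere (0 : EuclideanSpace ℝ (Fin n)) 1,
      0 < supportFn K u * Real.exp (t * logRatio K L u) := fun u =>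
    mul_pos (hK.supportFn_pos_of_sphere u) (Real.exp_pos _)
  have hφc : Continuous φ := by
    have h1 := hK.continuous_logRatio hL
    have h2 := hK.continuous_supportFn
    refine Continuous.div (by fun_prop) (by fun_prop) fun u => (hden u).ne'
  obtain ⟨u, -, hu⟩ := isCompact_univ.exists_isMaxOn ⟨u₁, mem_univ _⟩ hφc.continuousOn
  have hpos : 0 < φ u := by
    refine lt_of_lt_of_le ?_ (hu (mem_univ u₁))
    refine div_pos ?_ (hden u₁)
    rw [hu₁]
    simp only [inner_smul_right, real_inner_self_eq_norm_sq]
    positivity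
  have hmem : (φ u)⁻¹ • x ∈ L0Sum t K L := by
    rw [hK.mem_L0Sum_iff hL]
    intro v
    have hv : φ v ≤ φ u := hu (mem_univ v)
    rw [hφ] at hv
    simp only at hv
    rw [div_le_iff₀ (hden v)] at hv
    rw [inner_smul_left, conj_trivial, inv_mul_le_iff₀ hpos]
    exact hv
  refine ⟨u, ?_⟩
  rw [← hQ.gauge_le_one_iff, hQ.gauge_smul (by positivity), inv_mul_le_iff₀ hpos, mul_one] at hmem
  exact (le_div_iff₀ (hden u)).1 hmem

lemma exp_le_gauge_div_gauge (hK : IsCenteredBody K) {t : ℝ}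
    (hQ : IsCenteredBody (L0Sum t K L)) {x : EuclideanSpace ℝ (Fin n)} (hx : x ≠ 0)
    {u : sphere (0 : EuclideanSpace ℝ (Fin n)) 1}
    (hu : gauge (L0Sum t K L) x * (supportFn K u * Real.exp (t * logRatio K L u)) ≤
      inner ℝ x (u : EuclideanSpace ℝ (Fin n))) :
    Real.exp (t * logRatio K L u) ≤ gauge K x / gauge (L0Sum t K L) x := by
  have hq := hQ.gauge_pos hx
  have hk := hK.supportFn_pos_of_sphere u
  have h1 := hK.inner_le_supportFn_mul_gauge x u
  rw [le_div_iff₀ hq]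
  refine le_of_mul_le_mul_left ?_ hk
  linarith

/-- The upper bound uses a normal of `K`, the lower one an active direction of the `L₀`-sum. Divided
by `t`, this is the domination needed for the limit `t → 0`. -/
lemma abs_log_gauge_div_gauge_le (hK : IsCenteredBody K) (hL : IsCenteredBody L) {t M : ℝ}
    (ht : 0 ≤ t) (hQ : IsCenteredBody (L0Sum t K L)) (hM : ∀ u, |logRatio K L u| ≤ M)
    {x : EuclideanSpace ℝ (Fin n)} (hx : x ≠ 0) :
    |Real.log (gauge K x / gauge (L0Sum t K L) x)| ≤ t * M := by
  have hpos := div_pos (hK.gauge_pos hx) (hQ.gauge_pos hx)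
  obtain ⟨v, hv⟩ := hK.exists_isUnitNormal (hK.inv_gauge_smul_mem_frontier hx)
  rw [hK.isUnitNormal_inv_gauge_smul_iff hx] at hv
  obtain ⟨u, hu⟩ := hK.exists_gauge_L0Sum_mul_le hL hQ hx
  have h1 := (Real.log_le_iff_le_exp hpos).2 (hK.gauge_div_gauge_le hL hQ hx hv)
  have h2 := (Real.le_log_iff_exp_le hpos).2 (hK.exp_le_gauge_div_gauge hQ hx hu)
  have h3 := mul_le_mul_of_nonneg_left (abs_le.1 (hM v)).2 ht
  have h4 := mul_le_mul_of_nonneg_left (abs_le.1 (hM u)).1 ht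
  rw [abs_le]
  constructor <;> linarith

/-- The logarithmic derivative at `0` of the radial function of the `L₀`-sums, in a direction in
which `K` has a unique normal. -/
lemma tendsto_log_gauge_div_gauge (hK : IsCenteredBody K) (hL : IsCenteredBody L)
    (hQ : ∀ t ∈ Icc (0 : ℝ) 1, IsCenteredBody (L0Sum t K L))
    {x : EuclideanSpace ℝ (Fin n)} (hx : x ≠ 0) {v : sphere (0 : EuclideanSpace ℝ (Fin n)) 1}
    (hv : inner ℝ x (v : EuclideanSpace ℝ (Fin n)) = supportFn K v * gauge K x)
    (huniq : ∀ w : sphere (0 : EuclideanSpace ℝ (Fin n)) 1,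
      inner ℝ x (w : EuclideanSpace ℝ (Fin n)) = supportFn K w * gauge K x → w = v) :
    Tendsto (fun t => Real.log (gauge K x / gauge (L0Sum t K L) x) / t) (𝓝[>] 0)
      (𝓝 (logRatio K L v)) := by
  obtain ⟨M, hM0, hM⟩ := hK.exists_abs_logRatio_le hL
  have hG := hK.continuous_logRatio hL
  have hhK := hK.continuous_supportFn
  have hgx := hK.gauge_pos hx
  have hev : ∀ᶠ t : ℝ in 𝓝[>] 0, t ∈ Ioc (0 : ℝ) 1 := Ioc_mem_nhdsGT one_pos
  rw [tendsto_order]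
  constructor
  · intro a ha
    -- It suffices that the active direction avoids `Z` for small `t`. Since `v ∉ Z`, uniqueness of
    -- the normal and compactness keep `⟨x, u⟩ / (h_K(u) g_K(x))` below some `m < 1` on `Z`.
    set Z : Set (sphere (0 : EuclideanSpace ℝ (Fin n)) 1) := {u | logRatio K L u ≤ a} with hZ
    have hZc : IsCompact Z := (isClosed_le hG continuous_const).isCompact
    obtain ⟨m, hm1, hm⟩ : ∃ m < 1, ∀ u ∈ Z,
        inner ℝ x (u : EuclideanSpace ℝ (Fin n)) ≤ m * (supportFn K u * gauge K x) := by
      rcases Z.eq_empty_or_nonempty with hZe | hZn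
      · exact ⟨0, one_pos, by simp [hZe]⟩
      have hden : ∀ u : sphere (0 : EuclideanSpace ℝ (Fin n)) 1,
          0 < supportFn K u * gauge K x := fun u => mul_pos (hK.supportFn_pos_of_sphere u) hgx
      obtain ⟨w, hw, hmax⟩ := hZc.exists_isMaxOn hZn
        (f := fun u => inner ℝ x (u : EuclideanSpace ℝ (Fin n)) / (supportFn K u * gauge K x))
        (Continuous.div (by fun_prop) (by fun_prop) fun u => (hden u).ne').continuousOn
      refine ⟨_, ?_, fun u hu => (div_le_iff₀ (hden u)).1 (hmax hu)⟩
      rw [div_lt_one (hden w)]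
      refine lt_of_le_of_ne (hK.inner_le_supportFn_mul_gauge x w) fun h => ?_
      rw [huniq w h] at hw
      exact absurd ha (not_lt.2 hw)
    have hexp : Tendsto (fun t : ℝ => Real.exp (-(2 * t * M))) (𝓝[>] 0) (𝓝 1) := by
      have : Continuous fun t : ℝ => Real.exp (-(2 * t * M)) := by fun_prop
      have h0 := this.tendsto 0
      simp only [mul_zero, zero_mul, neg_zero, Real.exp_zero] at h0
      exact h0.mono_left nhdsWithin_le_nhds
    filter_upwards [hev, hexp.eventually_const_lt hm1] with t ht hmt
    have hQt := hQ t ⟨ht.1.le, ht.2⟩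
    have hq := hQt.gauge_pos hx
    have hpos := div_pos hgx hq
    obtain ⟨u, hu⟩ := hK.exists_gauge_L0Sum_mul_le hL hQt hx
    have hku := hK.supportFn_pos_of_sphere u
    have h2 := (Real.le_log_iff_exp_le hpos).2 (hK.exp_le_gauge_div_gauge hQt hx hu)
    have h3 := (abs_le.1 (hK.abs_log_gauge_div_gauge_le hL ht.1.le hQt hM hx)).2
    rw [lt_div_iff₀ ht.1]
    refine lt_of_lt_of_le ?_ h2
    rw [mul_comm]
    refine mul_lt_mul_of_pos_left ?_ ht.1
    -- An active direction in `Z` would force `exp(-2tM) ≤ m`: one factor `exp(-tM)` comes from the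
    -- Wulff function, the other from comparing the gauges.
    by_contra hc
    have h4 := hm u (not_lt.1 hc)
    have h5 : gauge K x ≤ Real.exp (t * M) * gauge (L0Sum t K L) x :=
      (div_le_iff₀ hq).1 ((Real.log_le_iff_le_exp hpos).1 h3)
    have h6 : Real.exp (-(t * M)) ≤ Real.exp (t * logRatio K L u) := by
      rw [Real.exp_le_exp]
      have := mul_le_mul_of_nonneg_left (abs_le.1 (hM u)).1 ht.1.le
      linarith
    have h7 : Real.exp (-(2 * t * M)) * (supportFn K u * gauge K x) ≤
        m * (supportFn K u * gauge K x) := by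
      refine le_trans ?_ (hu.trans h4)
      calc Real.exp (-(2 * t * M)) * (supportFn K u * gauge K x)
          ≤ Real.exp (-(2 * t * M)) * (supportFn K u *
              (Real.exp (t * M) * gauge (L0Sum t K L) x)) := by gcongr
        _ = gauge (L0Sum t K L) x * (supportFn K u * Real.exp (-(t * M))) := by
            have : Real.exp (-(2 * t * M)) * Real.exp (t * M) = Real.exp (-(t * M)) := by
              rw [← Real.exp_add]; congr 1; ring
            rw [← this]; ring
        _ ≤ _ := by gcongr
    exact absurd (le_of_mul_le_mul_right h7 (mul_pos hku hgx)) (not_le.2 hmt)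
  · intro a ha
    filter_upwards [hev] with t ht
    have hQt := hQ t ⟨ht.1.le, ht.2⟩
    refine lt_of_le_of_lt ?_ ha
    rw [div_le_iff₀ ht.1, mul_comm]
    exact (Real.log_le_iff_le_exp (div_pos hgx (hQt.gauge_pos hx))).2
      (hK.gauge_div_gauge_le hL hQt hx hv)

end IsCenteredBody

/-! ### First variation of volume -/

lemma nonempty_unit_sphere (hn : 1 ≤ n) : Nonempty (sphere (0 : EuclideanSpace ℝ (Fin n)) 1) := by
  have : Nonempty (Fin n) := ⟨⟨0, hn⟩⟩
  exact (NormedSpace.sphere_nonempty.2 zero_le_one).to_subtype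

lemma ae_ne_zero (hn : 1 ≤ n) (μ : Measure (EuclideanSpace ℝ (Fin n))) (hμ : μ ≪ volume) :
    ∀ᵐ x ∂μ, x ≠ 0 := by
  have : Nonempty (Fin n) := ⟨⟨0, hn⟩⟩
  exact hμ.ae_le (Measure.ae_ne volume 0)

namespace IsCenteredBody

lemma isFiniteMeasure_restrict (hK : IsCenteredBody K) :
    IsFiniteMeasure (volume.restrict K) := ⟨by
  rw [Measure.restrict_apply_univ]; exact hK.volume_lt_top⟩

lemma isFiniteMeasure_coneVolumeMeasure (hK : IsCenteredBody K) (hn : 1 ≤ n) :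
    IsFiniteMeasure (coneVolumeMeasure K) := by
  obtain ⟨u₀⟩ := nonempty_unit_sphere hn
  have := hK.isFiniteMeasure_restrict
  rw [hK.coneVolumeMeasure_eq_map hn u₀]
  infer_instance

lemma coneVolumeMeasure_univ (hK : IsCenteredBody K) (hn : 1 ≤ n) :
    coneVolumeMeasure K univ = volume K := by
  obtain ⟨u₀⟩ := nonempty_unit_sphere hn
  rw [hK.coneVolumeMeasure_eq_map hn u₀, Measure.map_apply (hK.measurable_coneNormal u₀) .univ,
    preimage_univ, Measure.restrict_apply_univ]

lemma integral_coneVolumeMeasure (hK : IsCenteredBody K) (hn : 1 ≤ n)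
    (u₀ : sphere (0 : EuclideanSpace ℝ (Fin n)) 1)
    {f : sphere (0 : EuclideanSpace ℝ (Fin n)) 1 → ℝ} (hf : Continuous f) :
    ∫ u, f u ∂(coneVolumeMeasure K) = ∫ x in K, f (coneNormal K u₀ x) := by
  rw [hK.coneVolumeMeasure_eq_map hn u₀,
    integral_map (hK.measurable_coneNormal u₀).aemeasurable hf.aestronglyMeasurable]

lemma integrable_logRatio (hK : IsCenteredBody K) (hL : IsCenteredBody L) (hn : 1 ≤ n) :
    Integrable (logRatio K L) (coneVolumeMeasure K) := by
  have := hK.isFiniteMeasure_coneVolumeMeasure hn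
  obtain ⟨M, -, hM⟩ := hK.exists_abs_logRatio_le hL
  exact Integrable.of_bound (hK.continuous_logRatio hL).aestronglyMeasurable M
    (Eventually.of_forall hM)

lemma integrableOn_logRatio_coneNormal (hK : IsCenteredBody K) (hL : IsCenteredBody L)
    (u₀ : sphere (0 : EuclideanSpace ℝ (Fin n)) 1) :
    IntegrableOn (fun x => logRatio K L (coneNormal K u₀ x)) K := by
  have := hK.isFiniteMeasure_restrict
  obtain ⟨M, -, hM⟩ := hK.exists_abs_logRatio_le hL
  exact Integrable.of_bound ((hK.continuous_logRatio hL).measurable.comp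
    (hK.measurable_coneNormal u₀)).aestronglyMeasurable M (Eventually.of_forall fun x => hM _)

lemma integrableOn_gauge_div_pow (hK : IsCenteredBody K) (hL : IsCenteredBody L) (hn : 1 ≤ n) :
    IntegrableOn (fun x => (gauge K x / gauge L x) ^ n) K := by
  have hm : Measurable fun x => (gauge K x / gauge L x) ^ n :=
    (hK.continuous_gauge.measurable.div hL.continuous_gauge.measurable).pow_const n
  refine ⟨hm.aestronglyMeasurable, ?_⟩
  have h0 : ∀ x, 0 ≤ (gauge K x / gauge L x) ^ n := fun x =>
    pow_nonneg (div_nonneg (gauge_nonneg x) (gauge_nonneg x)) n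
  rw [hasFiniteIntegral_iff_ofReal (Eventually.of_forall h0),
    ← hK.volume_eq_lintegral_gauge_div hL hn]
  exact hL.volume_lt_top

lemma volume_real_eq_integral (hK : IsCenteredBody K) (hL : IsCenteredBody L) (hn : 1 ≤ n) :
    volume.real L = ∫ x in K, (gauge K x / gauge L x) ^ n := by
  have h0 : ∀ x, 0 ≤ (gauge K x / gauge L x) ^ n := fun x =>
    pow_nonneg (div_nonneg (gauge_nonneg x) (gauge_nonneg x)) n
  rw [integral_eq_lintegral_of_nonneg_ae (Eventually.of_forall h0)
    (hK.integrableOn_gauge_div_pow hL hn).aestronglyMeasurable,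
    ← hK.volume_eq_lintegral_gauge_div hL hn]
  rfl

/-- Integrate the pointwise bound on the gauge quotient, using `exp y ≤ 1 + y + y²` for `|y| ≤ 1`.
-/
lemma volume_L0Sum_le (hK : IsCenteredBody K) (hL : IsCenteredBody L) (hn : 1 ≤ n) {t M : ℝ}
    (ht : 0 ≤ t) (hQ : IsCenteredBody (L0Sum t K L)) (hM : ∀ u, |logRatio K L u| ≤ M)
    (htM : n * t * M ≤ 1) :
    volume.real (L0Sum t K L) ≤ volume.real K +
      n * t * ∫ u, logRatio K L u ∂(coneVolumeMeasure K) + (n * t * M) ^ 2 * volume.real K := by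
  obtain ⟨u₀⟩ := nonempty_unit_sphere hn
  have := hK.isFiniteMeasure_restrict
  have hG := hK.integrableOn_logRatio_coneNormal hL u₀
  rw [hK.volume_real_eq_integral hQ hn, hK.integral_coneVolumeMeasure hn u₀
    (hK.continuous_logRatio hL)]
  have hint : IntegrableOn (fun x => 1 + n * t * logRatio K L (coneNormal K u₀ x) +
      (n * t * M) ^ 2) K :=
    ((integrable_const 1).add (hG.const_mul _)).add (integrable_const _)
  have hval : ∫ x in K, (1 + n * t * logRatio K L (coneNormal K u₀ x) + (n * t * M) ^ 2) =
      volume.real K + n * t * (∫ x in K, logRatio K L (coneNormal K u₀ x)) +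
        (n * t * M) ^ 2 * volume.real K := by
    rw [integral_add (f := fun x => 1 + n * t * logRatio K L (coneNormal K u₀ x))
      ((integrable_const 1).add (hG.const_mul _)) (integrable_const _),
      integral_add (integrable_const 1) (hG.const_mul _), integral_const_mul]
    simp [mul_comm]
  rw [← hval]
  refine integral_mono_ae (hK.integrableOn_gauge_div_pow hQ hn) hint ?_
  filter_upwards [ae_restrict_of_ae (hK.ae_mem_smoothBoundary hn)] with x ⟨hx, hxs⟩
  have h1 := hK.gauge_div_gauge_le hL hQ hx (hK.inner_coneNormal (u₀ := u₀) hx hxs)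
  set y := n * t * logRatio K L (coneNormal K u₀ x) with hy
  have hyM : |y| ≤ n * t * M := by
    rw [hy, abs_mul, abs_of_nonneg (by positivity)]
    gcongr
    exact hM _
  have h2 : (gauge K x / gauge (L0Sum t K L) x) ^ n ≤ Real.exp y := by
    refine (pow_le_pow_left₀ (div_nonneg (gauge_nonneg x) (gauge_nonneg x)) h1 n).trans ?_
    rw [← Real.exp_nat_mul, hy, mul_assoc]
  have h3 := (abs_le.1 (Real.abs_exp_sub_one_sub_id_le (hyM.trans htM))).2
  have h4 : y ^ 2 ≤ (n * t * M) ^ 2 := sq_le_sq' (abs_le.1 hyM).1 (abs_le.1 hyM).2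
  linarith

lemma integrableOn_log_gauge_div_gauge (hK : IsCenteredBody K) (hL : IsCenteredBody L)
    (hn : 1 ≤ n) {t : ℝ} (ht : 0 ≤ t) (hQ : IsCenteredBody (L0Sum t K L)) :
    IntegrableOn (fun x => Real.log (gauge K x / gauge (L0Sum t K L) x)) K := by
  have := hK.isFiniteMeasure_restrict
  obtain ⟨M, -, hM⟩ := hK.exists_abs_logRatio_le hL
  refine Integrable.of_bound (hK.continuous_gauge.measurable.div
    hQ.continuous_gauge.measurable).log.aestronglyMeasurable (t * M) ?_
  filter_upwards [ae_ne_zero hn _ Measure.absolutelyContinuous_restrict] with x hx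
  exact hK.abs_log_gauge_div_gauge_le hL ht hQ hM hx

/-- This is `exp y ≥ 1 + y` with `y = n log(g_K/g_{Q_t})`, integrated over `K`. The factor `t` is
split off to expose the quotient whose limit is known. -/
lemma le_volume_L0Sum (hK : IsCenteredBody K) (hL : IsCenteredBody L) (hn : 1 ≤ n) {t : ℝ}
    (ht : 0 < t) (hQ : IsCenteredBody (L0Sum t K L)) :
    volume.real K + n * t * ∫ x in K, Real.log (gauge K x / gauge (L0Sum t K L) x) / t ≤
      volume.real (L0Sum t K L) := by
  have := hK.isFiniteMeasure_restrict
  have hG := hK.integrableOn_log_gauge_div_gauge hL hn ht.le hQ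
  have hval : volume.real K + n * t * ∫ x in K, Real.log (gauge K x / gauge (L0Sum t K L) x) / t =
      ∫ x in K, (1 + n * Real.log (gauge K x / gauge (L0Sum t K L) x)) := by
    rw [integral_add (integrable_const 1) (hG.const_mul _), integral_const_mul, integral_div]
    field_simp
    simp
  rw [hval, hK.volume_real_eq_integral hQ hn]
  refine integral_mono_ae ((integrable_const 1).add (hG.const_mul _))
    (hK.integrableOn_gauge_div_pow hQ hn) ?_
  filter_upwards [ae_ne_zero hn _ Measure.absolutelyContinuous_restrict] with x hx
  have hpos := div_pos (hK.gauge_pos hx) (hQ.gauge_pos hx)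
  have h1 := Real.add_one_le_exp (n * Real.log (gauge K x / gauge (L0Sum t K L) x))
  rw [Real.exp_nat_mul, Real.exp_log hpos] at h1
  linarith

lemma tendsto_integral_log_gauge_div_gauge (hK : IsCenteredBody K) (hL : IsCenteredBody L)
    (hn : 1 ≤ n) (hQ : ∀ t ∈ Icc (0 : ℝ) 1, IsCenteredBody (L0Sum t K L)) :
    Tendsto (fun t => ∫ x in K, Real.log (gauge K x / gauge (L0Sum t K L) x) / t) (𝓝[>] 0)
      (𝓝 (∫ u, logRatio K L u ∂(coneVolumeMeasure K))) := by
  obtain ⟨u₀⟩ := nonempty_unit_sphere hn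
  have := hK.isFiniteMeasure_restrict
  obtain ⟨M, -, hM⟩ := hK.exists_abs_logRatio_le hL
  rw [hK.integral_coneVolumeMeasure hn u₀ (hK.continuous_logRatio hL)]
  have hev : ∀ᶠ t : ℝ in 𝓝[>] 0, t ∈ Ioc (0 : ℝ) 1 := Ioc_mem_nhdsGT one_pos
  refine tendsto_integral_filter_of_dominated_convergence (fun _ => M) ?_ ?_
    (integrable_const M) ?_
  · filter_upwards [hev] with t ht
    exact ((hK.integrableOn_log_gauge_div_gauge hL hn ht.1.le
      (hQ t ⟨ht.1.le, ht.2⟩)).div_const t).aestronglyMeasurable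
  · filter_upwards [hev] with t ht
    filter_upwards [ae_ne_zero hn _ Measure.absolutelyContinuous_restrict] with x hx
    rw [Real.norm_eq_abs, abs_div, abs_of_pos ht.1, div_le_iff₀ ht.1, mul_comm]
    exact hK.abs_log_gauge_div_gauge_le hL ht.1.le (hQ t ⟨ht.1.le, ht.2⟩) hM hx
  · filter_upwards [ae_restrict_of_ae (hK.ae_mem_smoothBoundary hn)] with x ⟨hx, hxs⟩
    have hv := hK.inner_coneNormal (u₀ := u₀) hx hxs
    refine hK.tendsto_log_gauge_div_gauge hL hQ hx hv fun w hw => ?_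
    rw [← hK.isUnitNormal_inv_gauge_smul_iff hx] at hv hw
    exact hxs.unique hw hv

end IsCenteredBody

/-! ### The inequality and its reverse -/

lemma rpow_one_sub_mul_rpow {a b : ℝ} (ha : 0 < a) (hb : 0 < b) (t : ℝ) :
    a ^ (1 - t) * b ^ t = a * Real.exp (t * Real.log (b / a)) := by
  rw [Real.log_div hb.ne' ha.ne', Real.rpow_def_of_pos ha, Real.rpow_def_of_pos hb,
    ← Real.exp_add]
  conv_rhs => rw [← Real.exp_log ha, Real.log_exp, ← Real.exp_add]
  congr 1
  ring

namespace IsCenteredBody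

/-- The logarithmic Minkowski inequality, from the logarithmic Brunn–Minkowski inequality on the
segment from `K` to `L`. -/
theorem le_integral_logRatio (hK : IsCenteredBody K) (hL : IsCenteredBody L) (hn : 1 ≤ n)
    (hQ : ∀ t ∈ Icc (0 : ℝ) 1, IsCenteredBody (L0Sum t K L))
    (hBM : ∀ t ∈ Ioo (0 : ℝ) 1,
      volume.real K ^ (1 - t) * volume.real L ^ t ≤ volume.real (L0Sum t K L)) :
    volume.real K / n * Real.log (volume.real L / volume.real K) ≤
      ∫ u, logRatio K L u ∂(coneVolumeMeasure K) := by
  obtain ⟨M, hM0, hM⟩ := hK.exists_abs_logRatio_le hL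
  set I := ∫ u, logRatio K L u ∂(coneVolumeMeasure K) with hI
  set l := Real.log (volume.real L / volume.real K) with hl
  have hVK := hK.volume_real_pos
  have hn0 : (0 : ℝ) < n := by exact_mod_cast hn
  have hlim : Tendsto (fun t : ℝ => n * I + t * (n * M) ^ 2 * volume.real K) (𝓝[>] 0)
      (𝓝 (n * I)) := by
    have : Continuous fun t : ℝ => n * I + t * (n * M) ^ 2 * volume.real K := by fun_prop
    have h0 := this.tendsto 0
    simp only [zero_mul, add_zero] at h0
    exact h0.mono_left nhdsWithin_le_nhds
  have hmain : volume.real K * l ≤ n * I := by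
    refine ge_of_tendsto hlim ?_
    -- Below this threshold both `t < 1` and `n t M ≤ 1` hold, as the two volume bounds require.
    have hpos : 0 < min 1 (1 / (n * M)) := by positivity
    filter_upwards [Ioo_mem_nhdsGT hpos] with t ht
    have ht0 := ht.1
    have ht1 : t < 1 := ht.2.trans_le (min_le_left _ _)
    have htM : n * t * M ≤ 1 := by
      have := (ht.2.trans_le (min_le_right _ _)).le
      rw [le_div_iff₀ (by positivity)] at this
      linarith
    have h1 := hBM t ⟨ht0, ht1⟩
    rw [rpow_one_sub_mul_rpow hVK hL.volume_real_pos] at h1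
    have h2 := hK.volume_L0Sum_le hL hn ht0.le (hQ t ⟨ht0.le, ht1.le⟩) hM htM
    have h3 := mul_le_mul_of_nonneg_left (Real.add_one_le_exp (t * l)) hVK.le
    refine le_of_mul_le_mul_left ?_ ht0
    nlinarith
  rw [div_mul_eq_mul_div, div_le_iff₀ hn0]
  linarith

/-- If the volume of the `L₀`-sums is at most log-linear, the logarithmic Minkowski inequality is
reversed. -/
theorem integral_logRatio_le (hK : IsCenteredBody K) (hL : IsCenteredBody L) (hn : 1 ≤ n)
    (hQ : ∀ t ∈ Icc (0 : ℝ) 1, IsCenteredBody (L0Sum t K L))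
    (hle : ∀ t ∈ Ioo (0 : ℝ) (1 / 2),
      volume.real (L0Sum t K L) ≤ volume.real K ^ (1 - t) * volume.real L ^ t) :
    ∫ u, logRatio K L u ∂(coneVolumeMeasure K) ≤
      volume.real K / n * Real.log (volume.real L / volume.real K) := by
  set l := Real.log (volume.real L / volume.real K) with hl
  have hVK := hK.volume_real_pos
  have hn0 : (0 : ℝ) < n := by exact_mod_cast hn
  have hlim := hK.tendsto_integral_log_gauge_div_gauge hL hn hQ
  -- The difference quotient at `0` of the log-linear bound `V(K) exp(t l)`, divided by `n`.
  have hder : Tendsto (fun t : ℝ => volume.real K / n * (t⁻¹ * (Real.exp (t * l) - 1))) (𝓝[>] 0)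
      (𝓝 (volume.real K / n * l)) := by
    have h1 : HasDerivAt (fun t : ℝ => Real.exp (t * l)) l 0 := by
      simpa using ((hasDerivAt_id (0 : ℝ)).mul_const l).exp
    have h2 := h1.hasDerivWithinAt (s := Ioi 0)
    rw [hasDerivWithinAt_iff_tendsto_slope' self_notMem_Ioi] at h2
    refine (h2.congr fun t => ?_).const_mul _
    simp [slope_def_field, div_eq_inv_mul]
  refine le_of_tendsto_of_tendsto hlim hder ?_
  filter_upwards [Ioo_mem_nhdsGT (by norm_num : (0 : ℝ) < 1 / 2)] with t ht
  have ht0 := ht.1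
  have h1 := hle t ht
  rw [rpow_one_sub_mul_rpow hVK hL.volume_real_pos] at h1
  have h2 := hK.le_volume_L0Sum hL hn ht0 (hQ t ⟨ht0.le, by linarith [ht.2]⟩)
  have h3 := h2.trans h1
  rw [div_mul_eq_mul_div, le_div_iff₀ hn0, ← mul_assoc, mul_comm (volume.real K), mul_assoc,
    inv_mul_eq_div, le_div_iff₀ ht0]
  linarith

end IsCenteredBody

end LogMinkowski

/-! ### The theorem and its equality cases -/

open LogMinkowski

theorem theorem6p2 (n : ℕ) (hn : 1 ≤ n) (C : Set (Set (EuclideanSpace ℝ (Fin n))))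
    (hC : LogMinkowski.IsAdmissibleClass C)
    (hBM : ∀ K ∈ C, ∀ L ∈ C, ∀ t ∈ Set.Ioo (0 : ℝ) 1,
      volume.real K ^ (1 - t) * volume.real L ^ t ≤ volume.real (LogMinkowski.L0Sum t K L))
    (K L : Set (EuclideanSpace ℝ (Fin n))) (hK : K ∈ C) (hL : L ∈ C) :
    Integrable (fun u : Metric.sphere (0 : EuclideanSpace ℝ (Fin n)) 1 =>
        Real.log (LogMinkowski.supportFn L u / LogMinkowski.supportFn K u))
      (LogMinkowski.coneVolumeMeasure K) ∧
    volume.real K / (n : ℝ) * Real.log (volume.real L / volume.real K) ≤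
      ∫ u : Metric.sphere (0 : EuclideanSpace ℝ (Fin n)) 1,
        Real.log (LogMinkowski.supportFn L u / LogMinkowski.supportFn K u)
          ∂(LogMinkowski.coneVolumeMeasure K) ∧
    ((∫ u : Metric.sphere (0 : EuclideanSpace ℝ (Fin n)) 1,
        Real.log (LogMinkowski.supportFn L u / LogMinkowski.supportFn K u)
          ∂(LogMinkowski.coneVolumeMeasure K) =
        volume.real K / (n : ℝ) * Real.log (volume.real L / volume.real K)) ↔
      volume.real (LogMinkowski.L0Sum (1 / 2) K L) =
        volume.real K ^ (1 / 2 : ℝ) * volume.real L ^ (1 / 2 : ℝ)) ∧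
    (LogMinkowski.coneVolumeMeasure K = LogMinkowski.coneVolumeMeasure L →
      volume.real (LogMinkowski.L0Sum (1 / 2) K L) =
        volume.real K ^ (1 / 2 : ℝ) * volume.real L ^ (1 / 2 : ℝ)) := by
  have hbody : ∀ K ∈ C, IsCenteredBody K := fun K hK =>
    ⟨hC.isConvexBody K hK, hC.zero_mem_interior K hK⟩
  have hLb := hbody L hL
  have hn0 : (0 : ℝ) < n := by exact_mod_cast hn
  have hmin : ∀ A ∈ C, ∀ B ∈ C,
      volume.real A / n * Real.log (volume.real B / volume.real A) ≤
        ∫ u, logRatio A B u ∂(coneVolumeMeasure A) := fun A hA B hB =>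
    (hbody A hA).le_integral_logRatio (hbody B hB) hn
      (fun t ht => hbody _ (hC.L0Sum_mem A hA B hB t ht)) (hBM A hA B hB)
  have hhalf : (1 / 2 : ℝ) ∈ Set.Icc (0 : ℝ) 1 := by norm_num
  have hHC := hC.L0Sum_mem K hK L hL _ hhalf
  have hHb := hbody _ hHC
  have hKb := hbody K hK
  have hVK := hKb.volume_real_pos
  have hVL := hLb.volume_real_pos
  have hVH := hHb.volume_real_pos
  have hlow := hBM K hK L hL (1 / 2) (by norm_num)
  have hsq := rpow_one_sub_mul_rpow hVK hVL (1 / 2)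
  have h12 : (1 : ℝ) - 1 / 2 = 1 / 2 := by norm_num
  rw [h12] at hlow hsq
  have hiff : (∫ u, logRatio K L u ∂(coneVolumeMeasure K) =
      volume.real K / n * Real.log (volume.real L / volume.real K)) ↔
      volume.real (L0Sum (1 / 2) K L) =
        volume.real K ^ (1 / 2 : ℝ) * volume.real L ^ (1 / 2 : ℝ) := by
    constructor
    · intro heq
      -- The inequality for `K` and the midpoint, with `log(h_H/h_K) ≤ ½ log(h_L/h_K)`, bounds the
      -- volume of the midpoint `H` from above.
      have h1 := hmin K hK _ hHC
      have h2 : ∫ u, logRatio K (L0Sum (1 / 2) K L) u ∂(coneVolumeMeasure K) ≤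
          ∫ u, 1 / 2 * logRatio K L u ∂(coneVolumeMeasure K) := by
        refine integral_mono (hKb.integrable_logRatio hHb hn)
          ((hKb.integrable_logRatio hLb hn).const_mul _) fun u => ?_
        have hk := hKb.supportFn_pos_of_sphere u
        have hq := hHb.supportFn_pos_of_sphere u
        refine (Real.log_le_iff_le_exp (div_pos hq hk)).2 ?_
        rw [div_le_iff₀ hk, mul_comm]
        exact hKb.supportFn_L0Sum_le hLb hHb u
      rw [integral_const_mul, heq] at h2
      have h3 : Real.log (volume.real (L0Sum (1 / 2) K L) / volume.real K) ≤
          1 / 2 * Real.log (volume.real L / volume.real K) := by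
        refine le_of_mul_le_mul_left ?_ (div_pos hVK hn0)
        linarith
      rw [Real.log_le_iff_le_exp (div_pos hVH hVK), div_le_iff₀ hVK, mul_comm, ← hsq] at h3
      exact le_antisymm h3 hlow
    · intro heq
      refine le_antisymm (hKb.integral_logRatio_le hLb hn
        (fun t ht => hbody _ (hC.L0Sum_mem K hK L hL t ht)) fun t ht => ?_) (hmin K hK L hL)
      have ht' : t ∈ Set.Icc (0 : ℝ) 1 := ⟨ht.1.le, by linarith [ht.2]⟩
      have hQC := hC.L0Sum_mem K hK L hL t ht'
      have hQb := hbody _ hQC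
      have hVQ := hQb.volume_real_pos
      have h1t : 0 < 1 - t := by linarith [ht.2]
      -- Chosen so that `(1 - s) t + s = 1/2`: the `L₀`-sum of `Q_t` and `L` with parameter `s` then
      -- lies in the midpoint, whose volume is known.
      set s := (1 / 2 - t) / (1 - t) with hs
      have hs0 : 0 < s := div_pos (by linarith [ht.2]) h1t
      have hs1 : s < 1 := (div_lt_one h1t).2 (by linarith)
      have hst : (1 - s) * (1 - t) = 1 / 2 := by rw [hs]; field_simp; ring
      have h1 := hBM _ hQC L hL s ⟨hs0, hs1⟩
      have hsub := hKb.L0Sum_L0Sum_subset hLb hQb ⟨hs0.le, hs1.le⟩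
      have harg : (1 - s) * t + s = 1 / 2 := by linarith
      rw [harg] at hsub
      have h2 := h1.trans (measureReal_mono hsub hHb.volume_lt_top.ne)
      rw [heq, hsq, rpow_one_sub_mul_rpow hVQ hVL] at h2
      rw [rpow_one_sub_mul_rpow hVK hVL]
      have h3 := Real.log_le_log (by positivity) h2
      refine (Real.log_le_log_iff hVQ (by positivity)).1 ?_
      rw [Real.log_mul hVQ.ne' (Real.exp_pos _).ne', Real.log_mul hVK.ne' (Real.exp_pos _).ne',
        Real.log_exp, Real.log_exp, Real.log_div hVL.ne' hVQ.ne',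
        Real.log_div hVL.ne' hVK.ne'] at h3
      rw [Real.log_mul hVK.ne' (Real.exp_pos _).ne', Real.log_exp,
        Real.log_div hVL.ne' hVK.ne']
      refine le_of_mul_le_mul_left ?_ (sub_pos.2 hs1)
      -- Dividing the logarithmic inequality by `1 - s` bounds `log V(Q_t)`, since `(1-s)(1-t) =
      -- 1/2` and `(1-s)t = 1/2 - s`.
      have h4 : (1 - s) * (Real.log (volume.real K) +
          t * (Real.log (volume.real L) - Real.log (volume.real K))) =
          1 / 2 * Real.log (volume.real K) + (1 / 2 - s) * Real.log (volume.real L) := by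
        linear_combination Real.log (volume.real K) * hst + Real.log (volume.real L) * harg
      linarith
  refine ⟨hKb.integrable_logRatio hLb hn, hmin K hK L hL, hiff, fun hV => hiff.1 ?_⟩
  -- The total mass of a cone volume measure is the volume. With equal volumes, exchanging `K` and
  -- `L` changes only the sign of the integral, so it vanishes.
  have hvol : volume.real K = volume.real L := by
    rw [measureReal_def, measureReal_def, ← hKb.coneVolumeMeasure_univ hn, hV,
      hLb.coneVolumeMeasure_univ hn]
  have h1 := hmin K hK L hL
  have h2 := hmin L hL K hK
  have hneg : ∀ u, logRatio L K u = - logRatio K L u := fun u => by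
    rw [logRatio, logRatio, ← Real.log_inv, inv_div]
  simp_rw [hneg, integral_neg] at h2
  rw [← hvol, ← hV] at h2
  rw [← hvol] at h1 ⊢
  simp only [div_self hVK.ne', Real.log_one, mul_zero] at h1 h2 ⊢
  linarith
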